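/- **Asymptotic MCRLB.** Let $K\ge 1$ and let $x_t=\sum_{k=1}^K \tilde a_k e^{i\tilde\varphi_k+i\tilde\omega_k t}$, with $\tilde a_k>0$ and $\tilde\varphi_k,\tilde\omega_k\in[-\pi,\pi)$. The signal is observed for $t=0,\dots,N-1$ in circularly symmetric white Gaussian noise of variance $\tilde\sigma^2>0$. For $\theta=(\omega_0,\varphi_1,\dots,\varphi_K,r_1,\dots,r_K)$ with $\omega_0,\varphi_k\in[-\pi,\pi)$ and $r_k>0$, let $\mu_t(\theta)=\sum_{k=1}^K r_k e^{i\varphi_k+ik\omega_0 t}$ and $\delta_t=\mu_t-x_t$. A pseudo-true parameter for $N$ samples is a global minimiser $\theta_0$ of $\frac1N\sum_{t=0}^{N-1}|x_t-\mu_t(\theta)|^2$ over all such $\theta$. Put $\sigma^2=\tilde\sigma^2+\frac1N\sum_{t=0}^{N-1}|\delta_t(\theta_0)|^2$ and, with all derivatives taken at $\theta_0$ and the superscripts $\mathfrak R,\mathfrak I$ denoting real and imaginary parts, $$F=\frac{2\tilde\sigma^2}{\sigma^4}\sum_{t=0}^{N-1}\Big(\nabla\mu_t^{\mathfrak R}(\nabla\mu_t^{\mathfrak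 R})^T+\nabla\mu_t^{\mathfrak I}(\nabla\mu_t^{\mathfrak I})^T\Big),\quad \tilde F=\frac{2}{\sigma^2}\sum_{t=0}^{N-1}\Big(\delta_t^{\mathfrak R}\nabla^2\mu_t^{\mathfrak R}+\delta_t^{\mathfrak I}\nabla^2\mu_t^{\mathfrak I}\Big),\quad A=-\frac{\sigma^2}{\tilde\sigma^2}F-\tilde F .$$ The misspecified Cramér–Rao bound $\mathrm{MCRLB}(\omega_0)$ for the pseudo-true fundamental frequency is the first diagonal element of $A^{-1}FA^{-1}$. With $\breve\phi_k=\varphi_k-\tilde\varphi_k$ and $\breve\omega_k=k\omega_0-\tilde\omega_k$, where $\omega_0,\varphi_k,r_k$ are the entries of $\theta_0$, define $$C=\frac{N(N^2-1)}{6}\sum_{k=1}^K k^2r_k^2,$$ $$Z=-2\sum_{k=1}^K k^2r_k^2\,\frac{N(N-1)(2N-1)}6+2\sum_{k=1}^K\sum_{t=0}^{N-1}k^2r_k\tilde a_k t^2\cos(\breve\phi_k+\breve\omega_kt),$$ $$D=2(N-1)\Big[\frac{N(N-1)}2\sum_{k=1}^K k^2r_k^2-\sum_{k=1}^K\sum_{t=0}^{N-1}k^2r_k\tilde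 a_k\,t\cos(\breve\phi_k+\breve\omega_kt)\Big],$$ $$E=\frac2N\sum_{k=1}^K k^2\tilde a_k^2\Big(\sum_{t=0}^{N-1}t\sin(\breve\phi_k+\breve\omega_kt)\Big)^2+\frac2N\sum_{k=1}^K k^2\Big(\tilde a_k\sum_{t=0}^{N-1}t\cos(\breve\phi_k+\breve\omega_kt)-r_k\frac{N(N-1)}2\Big)^2 .$$ Fix $c>0$ and $\kappa<1$, and call the signal *almost harmonic* at $\theta_0$ if the pseudo-true fundamental frequency is not too close to zero, $|\omega_0|\ge c$, and the inharmonicities are smaller than it, $|\tilde\omega_k-k\omega_0|\le\kappa|\omega_0|$ for $k=1,\dots,K$. 1. For every such signal there are $B$ and $N_0$ such that for all $N\ge N_0$ and every pseudo-true parameter $\theta_0$ for $N$ samples at which the signal is almost harmonic, $A$ is invertible, $C-E+Z+D>0$ and $$\Big|\mathrm{MCRLB}(\omega_0)-\tilde\sigma^2\frac{C+E}{(C-E+Z+D)^2}\Big|\le \frac{B}{N^{4}},$$ that is, $\mathrm{MCRLB}(\omega_0)=\tilde\sigma^2\frac{C+E}{(C-E+Z+D)^2}+\mathcal O(N^{-4})$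 as $N\to\infty$. 2. The error is moreover uniform in the signal, which may then vary with $N$: for all real $a$ and $\rho>0$ there are $B$ and $N_0$, depending only on $K,\tilde\sigma^2,c,\kappa,a,\rho$, such that for all $N\ge N_0$, all such signals with amplitudes $\tilde a_k\le a$, and all pseudo-true parameters $\theta_0$ for $N$ samples at which the signal is almost harmonic and $C-E+Z+D\ge\rho N^3$, the matrix $A$ is invertible and the same inequality holds. -/

import Mathlib

noncomputable section

namespace Inharmonic

/-- A noiseless signal model with `K` sinusoidal components: amplitudes `a k > 0`, initial phases
and angular frequencies in `[-π, π)`. The index `k : Fin K` stands for the component number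
`k + 1 ∈ {1, …, K}`. -/
structure SignalModel (K : ℕ) where
  amp : Fin K → ℝ
  phase : Fin K → ℝ
  freq : Fin K → ℝ
  amp_pos : ∀ k, 0 < amp k
  phase_mem : ∀ k, phase k ∈ Set.Ico (-Real.pi) Real.pi
  freq_mem : ∀ k, freq k ∈ Set.Ico (-Real.pi) Real.pi

/-- The noiseless waveform `x_t = ∑_k a_k exp(i φ_k + i ω_k t)`. -/
def SignalModel.wave {K : ℕ} (S : SignalModel K) (t : ℕ) : ℂ :=
  ∑ k : Fin K, (S.amp k : ℂ) *
    Complex.exp (Complex.I * (S.phase k : ℂ) + Complex.I * (S.freq k : ℂ) * (t : ℂ))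

/-- Index set of the `2 K + 1` real parameters of the harmonic model: the fundamental frequency,
the `K` phases and the `K` amplitudes, in this order. -/
abbrev ParamIdx (K : ℕ) : Type := Unit ⊕ (Fin K ⊕ Fin K)

/-- A parameter vector `θ = (ω₀, φ_1, …, φ_K, r_1, …, r_K)`. -/
abbrev Param (K : ℕ) : Type := ParamIdx K → ℝ

/-- The index of the fundamental frequency. -/
abbrev pitchIdx (K : ℕ) : ParamIdx K := Sum.inl ()

/-- The fundamental frequency `ω₀`. -/
def pitch {K : ℕ} (θ : Param K) : ℝ := θ (Sum.inl ())

/-- The phases `φ_k`. -/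
def phase {K : ℕ} (θ : Param K) (k : Fin K) : ℝ := θ (Sum.inr (Sum.inl k))

/-- The amplitudes `r_k`. -/
def amp {K : ℕ} (θ : Param K) (k : Fin K) : ℝ := θ (Sum.inr (Sum.inr k))

/-- The harmonic order `k ∈ {1, …, K}` as a real number. -/
def order {K : ℕ} (k : Fin K) : ℝ := ((k : ℕ) : ℝ) + 1

/-- The harmonic waveform `μ_t(θ) = ∑_k r_k exp(i φ_k + i k ω₀ t)`. -/
def harmWave {K : ℕ} (t : ℕ) (θ : Param K) : ℂ :=
  ∑ k : Fin K, (amp θ k : ℂ) *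
    Complex.exp (Complex.I * (phase θ k : ℂ) +
      Complex.I * ((order k : ℝ) : ℂ) * (pitch θ : ℂ) * (t : ℂ))

/-- The waveform difference `δ_t(θ) = μ_t(θ) - x_t`. -/
def waveDiff {K : ℕ} (S : SignalModel K) (t : ℕ) (θ : Param K) : ℂ :=
  harmWave t θ - S.wave t

/-- The least-squares criterion `(1/N) ∑_{t<N} |x_t - μ_t(θ)|²`. -/
def lsCost {K : ℕ} (S : SignalModel K) (N : ℕ) (θ : Param K) : ℝ :=
  (1 / (N : ℝ)) * ∑ t ∈ Finset.range N, ‖S.wave t - harmWave t θ‖ ^ 2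

/-- The parameter set of the harmonic model: `ω₀, φ_k ∈ [-π, π)` and `r_k > 0`. -/
def paramSet (K : ℕ) : Set (Param K) :=
  {θ | pitch θ ∈ Set.Ico (-Real.pi) Real.pi ∧
    (∀ k, phase θ k ∈ Set.Ico (-Real.pi) Real.pi) ∧ ∀ k, 0 < amp θ k}

/-- `θ` is a pseudo-true parameter for `N` samples: a global minimiser of the least-squares
criterion over the parameter set. -/
def IsPseudoTrue {K : ℕ} (S : SignalModel K) (N : ℕ) (θ : Param K) : Prop :=
  θ ∈ paramSet K ∧ IsMinOn (lsCost S N) (paramSet K) θ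

/-- The pseudo-true noise variance `σ² = s + (1/N) ∑_{t<N} |δ_t(θ)|²`, where `s` is the variance
of the actual noise. -/
def pseudoVar {K : ℕ} (S : SignalModel K) (s : ℝ) (N : ℕ) (θ : Param K) : ℝ :=
  s + (1 / (N : ℝ)) * ∑ t ∈ Finset.range N, ‖waveDiff S t θ‖ ^ 2

/-- The partial derivative of `f` at `θ` in the coordinate `i`. -/
def partialDeriv {K : ℕ} (i : ParamIdx K) (f : Param K → ℝ) (θ : Param K) : ℝ :=
  deriv (fun u : ℝ => f (Function.update θ i u)) (θ i)

/-- The gradient as a vector. -/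
def grad {K : ℕ} (f : Param K → ℝ) (θ : Param K) : ParamIdx K → ℝ :=
  fun i => partialDeriv i f θ

/-- The Hessian as a matrix. -/
def hess {K : ℕ} (f : Param K → ℝ) (θ : Param K) : Matrix (ParamIdx K) (ParamIdx K) ℝ :=
  Matrix.of fun i j => partialDeriv i (fun η => partialDeriv j f η) θ

/-- Real part of the harmonic waveform as a function of the parameters. -/
def harmRe {K : ℕ} (t : ℕ) (θ : Param K) : ℝ := (harmWave t θ).re

/-- Imaginary part of the harmonic waveform as a function of the parameters. -/
def harmIm {K : ℕ} (t : ℕ) (θ : Param K) : ℝ := (harmWave t θ).im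

/-- The matrix `F(θ) = (2 s / σ⁴) ∑_t (∇ μ_t^R (∇ μ_t^R)ᵀ + ∇ μ_t^I (∇ μ_t^I)ᵀ)`. -/
def matF {K : ℕ} (S : SignalModel K) (s : ℝ) (N : ℕ) (θ : Param K) :
    Matrix (ParamIdx K) (ParamIdx K) ℝ :=
  (2 * s / pseudoVar S s N θ ^ 2) • ∑ t ∈ Finset.range N,
    (Matrix.vecMulVec (grad (harmRe t) θ) (grad (harmRe t) θ) +
      Matrix.vecMulVec (grad (harmIm t) θ) (grad (harmIm t) θ))

/-- The matrix `F̃(θ) = (2 / σ²) ∑_t (δ_t^R ∇² μ_t^R + δ_t^I ∇² μ_t^I)`. -/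
def matFtilde {K : ℕ} (S : SignalModel K) (s : ℝ) (N : ℕ) (θ : Param K) :
    Matrix (ParamIdx K) (ParamIdx K) ℝ :=
  (2 / pseudoVar S s N θ) • ∑ t ∈ Finset.range N,
    ((waveDiff S t θ).re • hess (harmRe t) θ + (waveDiff S t θ).im • hess (harmIm t) θ)

/-- The matrix `A(θ) = -(σ² / s) F(θ) - F̃(θ)`. -/
def matA {K : ℕ} (S : SignalModel K) (s : ℝ) (N : ℕ) (θ : Param K) :
    Matrix (ParamIdx K) (ParamIdx K) ℝ :=
  -((pseudoVar S s N θ / s) • matF S s N θ) - matFtilde S s N θ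

/-- The misspecified Cramér-Rao bound for the fundamental frequency: the first diagonal element
of `A⁻¹ F A⁻¹`. -/
def mcrlbPitch {K : ℕ} (S : SignalModel K) (s : ℝ) (N : ℕ) (θ : Param K) : ℝ :=
  ((matA S s N θ)⁻¹ * matF S s N θ * (matA S s N θ)⁻¹) (pitchIdx K) (pitchIdx K)

/-- The argument `(φ_k - φ̃_k) + (k ω₀ - ω̃_k) t`, where the tilded quantities belong to the
actual signal. -/
def angle {K : ℕ} (S : SignalModel K) (θ : Param K) (k : Fin K) (t : ℕ) : ℝ :=
  (phase θ k - S.phase k) + (order k * pitch θ - S.freq k) * (t : ℝ)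

/-- The term `C`. -/
def termC {K : ℕ} (N : ℕ) (θ : Param K) : ℝ :=
  (N : ℝ) * ((N : ℝ) ^ 2 - 1) * (∑ k : Fin K, order k ^ 2 * amp θ k ^ 2) / 6

/-- The term `Z`. -/
def termZ {K : ℕ} (S : SignalModel K) (N : ℕ) (θ : Param K) : ℝ :=
  -2 * (∑ k : Fin K, order k ^ 2 * amp θ k ^ 2 *
      ((N : ℝ) * ((N : ℝ) - 1) * (2 * (N : ℝ) - 1) / 6)) +
    2 * ∑ k : Fin K, ∑ t ∈ Finset.range N,
      order k ^ 2 * amp θ k * S.amp k * (t : ℝ) ^ 2 * Real.cos (angle S θ k t)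

/-- The term `D`. -/
def termD {K : ℕ} (S : SignalModel K) (N : ℕ) (θ : Param K) : ℝ :=
  2 * ((N : ℝ) - 1) *
    ((N : ℝ) * ((N : ℝ) - 1) / 2 * (∑ k : Fin K, order k ^ 2 * amp θ k ^ 2) -
      ∑ k : Fin K, ∑ t ∈ Finset.range N,
        order k ^ 2 * amp θ k * S.amp k * (t : ℝ) * Real.cos (angle S θ k t))

/-- The term `E`. -/
def termE {K : ℕ} (S : SignalModel K) (N : ℕ) (θ : Param K) : ℝ :=
  2 / (N : ℝ) * (∑ k : Fin K, order k ^ 2 * S.amp k ^ 2 *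
      (∑ t ∈ Finset.range N, (t : ℝ) * Real.sin (angle S θ k t)) ^ 2) +
    2 / (N : ℝ) * ∑ k : Fin K, order k ^ 2 *
      (S.amp k * (∑ t ∈ Finset.range N, (t : ℝ) * Real.cos (angle S θ k t)) -
        amp θ k * ((N : ℝ) * ((N : ℝ) - 1) / 2)) ^ 2

/-- The denominator `C - E + Z + D` before squaring. -/
def denom {K : ℕ} (S : SignalModel K) (N : ℕ) (θ : Param K) : ℝ :=
  termC N θ - termE S N θ + termZ S N θ + termD S N θ

/-- Almost harmonic with respect to the fundamental frequency of `θ`: that frequency is not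
closer than `c` to zero, and every inharmonicity `Δ_k = ω̃_k - k ω₀` is at most `κ |ω₀|`. -/
def AlmostHarmonic {K : ℕ} (S : SignalModel K) (c κ : ℝ) (θ : Param K) : Prop :=
  c ≤ |pitch θ| ∧ ∀ k, |S.freq k - order k * pitch θ| ≤ κ * |pitch θ|

end Inharmonic

end

/-! Write e_k for the tones of the harmonic model, G for the Gram matrix of the gradients of μ, and
H for the sum of second derivatives of μ weighted by δ. Then F = (2s/σ⁴) G and A = -(2/σ²)(G + H),
so σ² cancels and the bound is s/2 times the pitch entry of (G + H)⁻¹ G (G + H)⁻¹. The least-squares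
criterion is 2π-periodic in all angles, so a pseudo-true parameter satisfies the first-order
conditions even at the end of the half-open box. These say that δ is orthogonal to every e_k
(`resid_zero_eq_zero`). Hence H vanishes on the nuisance coordinates, G and G + H share the block B
there, and a Schur complement gives the entry in closed form (`mcrlbPitch_eq`). The amplitudes r_k
enter B only as a diagonal rescaling, which cancels; no lower bound on r_k is needed.

Almost harmonicity keeps tones of different order apart modulo 2π by (1-κ)c. Summation by parts
bounds their correlations with weight t^j by O(N^j), one power of N below the coherent size. So B =
N·1 + O(1), the borders and corners equal explicit diagonal sums up to a lower order, and numerator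
and denominator of the Schur formula are (C+E)/2 and (C-E+Z+D)/2 up to O(N²). If C-E+Z+D is at least
ρN³, the quotient is accurate to O(N⁻⁴) (`mcrlb_isBigO`). This is the second claim; uniformity is
obtained by letting signal and parameter run along a filter that controls only N.

For a fixed signal the lower bound on the denominator has to be proved. Comparison with a
single-tone competitor shows that some harmonic k lies within O(1/N) of its component
(`exists_active`). With f = ω̃_k/k, a second competitor reproduces all components whose frequencies
are exact multiples of f by their own order. Minimality then makes the total deviation from these
components bounded in energy (`deviation_isBigO`). Consequently E, Z and D are o(N³) while C is at
least a constant times N³ (`exists_denom_ge`). -/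

noncomputable section

namespace Inharmonic
open Filter Asymptotics Topology ComplexConjugate

/-! ### Oscillating sums -/

/-- The complex exponential `exp(i (β + α t))` sampled at the integer `t`. -/
def tone (β α : ℝ) (t : ℕ) : ℂ := Complex.exp (((β + α * t : ℝ) : ℂ) * Complex.I)

theorem norm_tone (β α : ℝ) (t : ℕ) : ‖tone β α t‖ = 1 :=
  Complex.norm_exp_ofReal_mul_I _

theorem tone_re (β α : ℝ) (t : ℕ) : (tone β α t).re = Real.cos (β + α * t) :=
  Complex.exp_ofReal_mul_I_re _

theorem tone_im (β α : ℝ) (t : ℕ) : (tone β α t).im = Real.sin (β + α * t) :=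
  Complex.exp_ofReal_mul_I_im _

theorem conj_tone (β α : ℝ) (t : ℕ) : conj (tone β α t) = tone (-β) (-α) t := by
  rw [tone, tone, ← Complex.exp_conj]
  congr 1
  simp
  ring

theorem conj_tone_mul_tone (β α β' α' : ℝ) (t : ℕ) :
    conj (tone β α t) * tone β' α' t = tone (β' - β) (α' - α) t := by
  rw [conj_tone, tone, tone, tone, ← Complex.exp_add]
  congr 1
  push_cast
  ring

theorem conj_tone_mul_self (β α : ℝ) (t : ℕ) : conj (tone β α t) * tone β α t = 1 := by
  rw [conj_tone_mul_tone]
  simp [tone]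

/-- Abel summation: adding the boundary term w_n z^n to (1-z) times the partial sum gives a quantity
whose increments are (w_{n+1}-w_n) z^{n+1}. Their norms telescope because w is monotone. -/
theorem norm_one_sub_mul_sum_le {z : ℂ} (hz : ‖z‖ = 1) {w : ℕ → ℝ} (hw : Monotone w)
    (h0 : 0 ≤ w 0) (N : ℕ) :
    ‖(1 - z) * ∑ t ∈ Finset.range N, (w t : ℂ) * z ^ t‖ ≤ 2 * w N := by
  have hpos : ∀ n, 0 ≤ w n := fun n => h0.trans (hw (Nat.zero_le n))
  have key : ∀ n, ‖(1 - z) * ∑ t ∈ Finset.range n, (w t : ℂ) * z ^ t + (w n : ℂ) * z ^ n‖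
      ≤ w n := by
    intro n
    induction n with
    | zero => simp [abs_of_nonneg h0]
    | succ n ih =>
      have : (1 - z) * ∑ t ∈ Finset.range (n + 1), (w t : ℂ) * z ^ t +
          (w (n + 1) : ℂ) * z ^ (n + 1) =
          ((1 - z) * ∑ t ∈ Finset.range n, (w t : ℂ) * z ^ t + (w n : ℂ) * z ^ n) +
            ((w (n + 1) - w n : ℝ) : ℂ) * z ^ (n + 1) := by
        rw [Finset.sum_range_succ]
        push_cast
        ring
      rw [this]
      refine (norm_add_le _ _).trans ?_
      have h2 : ‖((w (n + 1) - w n : ℝ) : ℂ) * z ^ (n + 1)‖ = w (n + 1) - w n := by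
        rw [norm_mul, norm_pow, hz, one_pow, mul_one, Complex.norm_real, Real.norm_eq_abs,
          abs_of_nonneg (sub_nonneg.2 (hw (Nat.le_succ n)))]
      linarith
  have h1 := key N
  have h2 : ‖(w N : ℂ) * z ^ N‖ = w N := by
    rw [norm_mul, norm_pow, hz, one_pow, mul_one, Complex.norm_real, Real.norm_eq_abs,
      abs_of_nonneg (hpos N)]
  have h3 := norm_sub_le ((1 - z) * ∑ t ∈ Finset.range N, (w t : ℂ) * z ^ t + (w N : ℂ) * z ^ N)
    ((w N : ℂ) * z ^ N)
  rw [add_sub_cancel_right] at h3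
  linarith

/-- The norm is 2|sin(α/2)|, and Jordan's inequality sin x ≥ 2x/π applies to |α|/2 or to π-|α|/2,
whichever is at most π/2. -/
theorem two_mul_div_pi_le_norm_one_sub_exp {ε α : ℝ} (h0 : 0 ≤ ε) (h1 : ε ≤ |α|)
    (h2 : |α| ≤ 2 * Real.pi - ε) :
    2 * ε / Real.pi ≤ ‖1 - Complex.exp ((α : ℂ) * Complex.I)‖ := by
  have hpi := Real.pi_pos
  have hn : ‖1 - Complex.exp ((α : ℂ) * Complex.I)‖ = 2 * |Real.sin (α / 2)| := by
    rw [norm_sub_rev, mul_comm, Complex.norm_exp_I_mul_ofReal_sub_one]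
    simp
  have habs : |Real.sin (α / 2)| = |Real.sin (|α| / 2)| := by
    rcases abs_cases α with ⟨h, _⟩ | ⟨h, _⟩ <;> rw [h]
    rw [neg_div, Real.sin_neg, abs_neg]
  have hsin : ε / Real.pi ≤ Real.sin (|α| / 2) := by
    rcases le_total (|α|) Real.pi with h | h
    · have := Real.mul_le_sin (x := |α| / 2) (by positivity) (by linarith)
      refine le_trans ?_ this
      rw [show 2 / Real.pi * (|α| / 2) = |α| / Real.pi by ring]
      gcongr
    · have := Real.mul_le_sin (x := Real.pi - |α| / 2) (by linarith) (by linarith)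
      rw [Real.sin_pi_sub] at this
      refine le_trans ?_ this
      rw [show 2 / Real.pi * (Real.pi - |α| / 2) = (2 * Real.pi - |α|) / Real.pi by ring]
      gcongr
      linarith
  rw [hn, habs, abs_of_nonneg ((div_nonneg h0 hpi.le).trans hsin), mul_div_assoc]
  linarith

/-- The sum `∑_{t<N} t^j exp(i (β + α t))`. -/
def oscSum (j N : ℕ) (β α : ℝ) : ℂ := ∑ t ∈ Finset.range N, (t : ℂ) ^ j * tone β α t

theorem norm_oscSum_le {ε α : ℝ} (h0 : 0 < ε) (h1 : ε ≤ |α|) (h2 : |α| ≤ 2 * Real.pi - ε)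
    (j N : ℕ) (β : ℝ) : ‖oscSum j N β α‖ ≤ Real.pi / ε * (N : ℝ) ^ j := by
  have hpi := Real.pi_pos
  set z : ℂ := Complex.exp ((α : ℂ) * Complex.I) with hz
  have hz1 : ‖z‖ = 1 := Complex.norm_exp_ofReal_mul_I _
  have hfac : oscSum j N β α = Complex.exp ((β : ℂ) * Complex.I) *
      ∑ t ∈ Finset.range N, (((t : ℝ) ^ j : ℝ) : ℂ) * z ^ t := by
    rw [oscSum, Finset.mul_sum]
    refine Finset.sum_congr rfl fun t _ => ?_
    have : tone β α t = Complex.exp ((β : ℂ) * Complex.I) * z ^ t := by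
      rw [tone, hz, ← Complex.exp_nat_mul, ← Complex.exp_add]
      congr 1
      push_cast
      ring
    rw [this]
    push_cast
    ring
  have hmono : Monotone fun t : ℕ => (t : ℝ) ^ j := fun a b hab => by
    have : (a : ℝ) ≤ b := by exact_mod_cast hab
    dsimp only
    gcongr
  have hb := norm_one_sub_mul_sum_le hz1 hmono (by positivity) N
  have hl := two_mul_div_pi_le_norm_one_sub_exp h0.le h1 h2
  rw [← hz] at hl
  rw [hfac, norm_mul, Complex.norm_exp_ofReal_mul_I, one_mul]
  rw [norm_mul] at hb
  set s := ‖∑ t ∈ Finset.range N, (((t : ℝ) ^ j : ℝ) : ℂ) * z ^ t‖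
  have hs : 0 ≤ s := norm_nonneg _
  have h3 : 2 * ε / Real.pi * s ≤ 2 * (N : ℝ) ^ j := (mul_le_mul_of_nonneg_right hl hs).trans hb
  rw [div_mul_eq_mul_div, le_div_iff₀ h0]
  rw [div_mul_eq_mul_div, div_le_iff₀ hpi] at h3
  linarith

theorem norm_oscSum_le_pow (j N : ℕ) (β α : ℝ) : ‖oscSum j N β α‖ ≤ (N : ℝ) ^ (j + 1) := by
  refine (norm_sum_le _ _).trans ?_
  have : ∀ t ∈ Finset.range N, ‖(t : ℂ) ^ j * tone β α t‖ ≤ (N : ℝ) ^ j := fun t ht => by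
    rw [norm_mul, norm_tone, mul_one, norm_pow, Complex.norm_natCast]
    have : (t : ℝ) ≤ N := by exact_mod_cast (Finset.mem_range.1 ht).le
    gcongr
  refine (Finset.sum_le_sum this).trans ?_
  rw [Finset.sum_const, Finset.card_range, nsmul_eq_mul, pow_succ, mul_comm]

/-! ### Frequencies of almost harmonic signals -/

theorem one_le_order {K : ℕ} (k : Fin K) : 1 ≤ order k := by simp [order]

theorem order_le {K : ℕ} (k : Fin K) : order k ≤ K := by
  have : (k : ℕ) + 1 ≤ K := k.2
  rw [order]
  exact_mod_cast this

theorem one_le_abs_order_sub {K : ℕ} {k l : Fin K} (h : k ≠ l) : 1 ≤ |order k - order l| := by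
  have h1 : ((k : ℕ) : ℤ) - ((l : ℕ) : ℤ) ≠ 0 := by
    intro h2
    apply h
    ext
    omega
  have h2 := Int.one_le_abs h1
  have h3 : (order k - order l : ℝ) = (((k : ℕ) : ℤ) - ((l : ℕ) : ℤ) : ℤ) := by
    simp [order]
  rw [h3]
  exact_mod_cast h2

theorem abs_order_sub_le {K : ℕ} (k l : Fin K) : |order k - order l| ≤ K - 1 := by
  have := one_le_order k
  have := one_le_order l
  have := order_le k
  have := order_le l
  rw [abs_le]
  constructor <;> linarith

section
variable {K : ℕ} {S : SignalModel K} {θ : Param K} {c κ : ℝ}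

theorem AlmostHarmonic.kappa_nonneg (h : AlmostHarmonic S c κ θ) (hc : 0 < c) (k : Fin K) :
    0 ≤ κ := by
  by_contra hk
  have h1 := (abs_nonneg _).trans (h.2 k)
  have h2 : 0 < |pitch θ| := hc.trans_le h.1
  nlinarith

/-- The top harmonic K|ω₀| exceeds |ω̃_K| ≤ π by at most κ|ω₀|. This keeps differences of harmonics
away from 2π and so excludes aliasing. -/
theorem AlmostHarmonic.mul_abs_pitch_le (h : AlmostHarmonic S c κ θ) (hK : 0 < K) :
    (K - κ) * |pitch θ| ≤ Real.pi := by
  obtain ⟨n, rfl⟩ : ∃ n, K = n + 1 := ⟨K - 1, by omega⟩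
  have h1 := h.2 (Fin.last n)
  have h2 : |S.freq (Fin.last n)| ≤ Real.pi :=
    abs_le.2 ⟨(S.freq_mem _).1, (S.freq_mem _).2.le⟩
  have h3 : |order (Fin.last n) * pitch θ| = ((n + 1 : ℕ) : ℝ) * |pitch θ| := by
    rw [abs_mul]
    congr 1
    simp only [order, Fin.val_last]
    push_cast
    exact abs_of_nonneg (by positivity)
  have h4 := abs_sub_abs_le_abs_sub (order (Fin.last n) * pitch θ) (S.freq (Fin.last n))
  rw [abs_sub_comm] at h1
  rw [sub_mul]
  linarith

theorem AlmostHarmonic.harm_separated (h : AlmostHarmonic S c κ θ) (hc : 0 < c) (hκ : κ < 1)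
    {k l : Fin K} (hkl : k ≠ l) :
    (1 - κ) * c ≤ |order k * pitch θ - order l * pitch θ| ∧
      |order k * pitch θ - order l * pitch θ| ≤ 2 * Real.pi - (1 - κ) * c := by
  have hK : 0 < K := k.pos
  have h0 := h.kappa_nonneg hc k
  have h1 := h.mul_abs_pitch_le hK
  have h2 := one_le_abs_order_sub hkl
  have h3 := abs_order_sub_le k l
  have h4 := h.1
  have hpi := Real.pi_pos
  rw [← sub_mul, abs_mul]
  set w := |pitch θ|
  have hw : 0 < w := hc.trans_le h4
  constructor <;> nlinarith

theorem AlmostHarmonic.cross_separated (h : AlmostHarmonic S c κ θ) (hc : 0 < c) (hκ : κ < 1)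
    {k l : Fin K} (hkl : k ≠ l) :
    (1 - κ) * c ≤ |order k * pitch θ - S.freq l| ∧
      |order k * pitch θ - S.freq l| ≤ 2 * Real.pi - (1 - κ) * c := by
  have hK : 0 < K := k.pos
  have h0 := h.kappa_nonneg hc k
  have h1 := h.mul_abs_pitch_le hK
  have h2 := one_le_abs_order_sub hkl
  have h3 := abs_order_sub_le k l
  have h4 := h.1
  have h5 := h.2 l
  have h6 : |order k * pitch θ - order l * pitch θ| = |order k - order l| * |pitch θ| := by
    rw [← sub_mul, abs_mul]
  have h7 := abs_sub_abs_le_abs_sub (order k * pitch θ - order l * pitch θ)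
    (S.freq l - order l * pitch θ)
  have h8 := abs_sub (order k * pitch θ - order l * pitch θ) (S.freq l - order l * pitch θ)
  rw [sub_sub_sub_cancel_right, h6] at h7 h8
  set w := |pitch θ|
  have hw : 0 < w := hc.trans_le h4
  -- Two distinct orders exist, so K ≥ 2 > 2κ. The upper bound then follows from (K-1+κ)|ω₀| +
  -- (1-κ)|ω₀| = K|ω₀| ≤ 2(K-κ)|ω₀| ≤ 2π.
  have hK2 : (2 : ℝ) ≤ K := by linarith
  constructor <;> nlinarith

/-- For equal orders there is no lower separation, but this still bounds the frequency difference by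
π, far from the aliasing point 2π. -/
theorem AlmostHarmonic.abs_pitch_le (h : AlmostHarmonic S c κ θ)
    (hκ : κ < 1) (k : Fin K) : |order k * pitch θ - S.freq k| ≤ |pitch θ| := by
  rw [abs_sub_comm]
  have := h.2 k
  have h2 := abs_nonneg (pitch θ)
  nlinarith

end

/-! ### Derivatives of the harmonic waveform -/

section
variable {K : ℕ}

/-- The `k`-th tone of the harmonic model. -/
def harmTone (θ : Param K) (k : Fin K) (t : ℕ) : ℂ := tone (phase θ k) (order k * pitch θ) t

/-- The `k`-th tone of the signal. -/
def sigTone (S : SignalModel K) (k : Fin K) (t : ℕ) : ℂ := tone (S.phase k) (S.freq k) t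

theorem harmWave_eq (θ : Param K) (t : ℕ) :
    harmWave t θ = ∑ k, (amp θ k : ℂ) * harmTone θ k t := by
  refine Finset.sum_congr rfl fun k _ => ?_
  rw [harmTone, tone]
  congr 2
  push_cast
  ring

theorem wave_eq (S : SignalModel K) (t : ℕ) :
    S.wave t = ∑ k, (S.amp k : ℂ) * sigTone S k t := by
  refine Finset.sum_congr rfl fun k _ => ?_
  rw [sigTone, tone]
  congr 2
  push_cast
  ring

/-- The partial derivative of the amplitude `r_k` in the coordinate `i`. -/
def ampRate (i : ParamIdx K) (k : Fin K) : ℝ := if i = Sum.inr (Sum.inr k) then 1 else 0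

/-- The partial derivative of the argument `φ_k + k ω₀ t` in the coordinate `i`. -/
def argRate (i : ParamIdx K) (k : Fin K) (t : ℕ) : ℝ :=
  (if i = Sum.inr (Sum.inl k) then 1 else 0) + order k * t * (if i = Sum.inl () then 1 else 0)

theorem hasDerivAt_update_apply (θ : Param K) (i j : ParamIdx K) :
    HasDerivAt (fun u => Function.update θ i u j) (if i = j then 1 else 0) (θ i) := by
  by_cases h : i = j
  · subst h
    simpa using hasDerivAt_id' (θ i)
  · simp [Function.update_of_ne (Ne.symm h), h, hasDerivAt_const]

theorem hasDerivAt_amp (θ : Param K) (i : ParamIdx K) (k : Fin K) :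
    HasDerivAt (fun u => ((amp (Function.update θ i u) k : ℝ) : ℂ)) (ampRate i k : ℂ) (θ i) :=
  (hasDerivAt_update_apply θ i _).ofReal_comp

theorem hasDerivAt_harmTone (θ : Param K) (i : ParamIdx K) (k : Fin K) (t : ℕ) :
    HasDerivAt (fun u => harmTone (Function.update θ i u) k t)
      (Complex.I * argRate i k t * harmTone θ k t) (θ i) := by
  have h1 : HasDerivAt (fun u => phase (Function.update θ i u) k +
      order k * pitch (Function.update θ i u) * t) (argRate i k t) (θ i) := by
    refine ((hasDerivAt_update_apply θ i (Sum.inr (Sum.inl k))).add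
      (((hasDerivAt_update_apply θ i (Sum.inl ())).const_mul (order k)).mul_const
        (t : ℝ))).congr_deriv ?_
    simp only [argRate]
    ring
  refine (h1.ofReal_comp.mul_const Complex.I).cexp.congr_deriv ?_
  rw [Function.update_eq_self, harmTone, tone]
  ring

/-- The partial derivatives of the harmonic waveform. -/
def waveGrad (t : ℕ) (θ : Param K) (i : ParamIdx K) : ℂ :=
  ∑ k, (ampRate i k + amp θ k * (Complex.I * argRate i k t)) * harmTone θ k t

/-- The second partial derivatives of the harmonic waveform. -/
def waveHess (t : ℕ) (θ : Param K) (i j : ParamIdx K) : ℂ :=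
  ∑ k, (ampRate i k * (Complex.I * argRate j k t) + ampRate j k * (Complex.I * argRate i k t) -
    amp θ k * (argRate i k t * argRate j k t)) * harmTone θ k t

theorem hasDerivAt_harmWave (θ : Param K) (i : ParamIdx K) (t : ℕ) :
    HasDerivAt (fun u => harmWave t (Function.update θ i u)) (waveGrad t θ i) (θ i) := by
  simp only [harmWave_eq, waveGrad]
  refine HasDerivAt.fun_sum fun k _ => ?_
  refine ((hasDerivAt_amp θ i k).mul (hasDerivAt_harmTone θ i k t)).congr_deriv ?_
  rw [Function.update_eq_self]
  ring

theorem hasDerivAt_waveGrad (θ : Param K) (i j : ParamIdx K) (t : ℕ) :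
    HasDerivAt (fun u => waveGrad t (Function.update θ i u) j) (waveHess t θ i j) (θ i) := by
  simp only [waveGrad, waveHess]
  refine HasDerivAt.fun_sum fun k _ => ?_
  refine ((((hasDerivAt_amp θ i k).mul_const (Complex.I * argRate j k t)).const_add
    (ampRate j k : ℂ)).mul (hasDerivAt_harmTone θ i k t)).congr_deriv ?_
  rw [Function.update_eq_self]
  linear_combination (amp θ k * argRate i k t * argRate j k t : ℂ) * harmTone θ k t *
    Complex.I_mul_I

theorem HasDerivAt.complex_re {f : ℝ → ℂ} {f' : ℂ} {x : ℝ} (h : HasDerivAt f f' x) :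
    HasDerivAt (fun u => (f u).re) f'.re x :=
  (Complex.reCLM.hasFDerivAt.comp_hasDerivAt x h)

theorem HasDerivAt.complex_im {f : ℝ → ℂ} {f' : ℂ} {x : ℝ} (h : HasDerivAt f f' x) :
    HasDerivAt (fun u => (f u).im) f'.im x :=
  (Complex.imCLM.hasFDerivAt.comp_hasDerivAt x h)

theorem partialDeriv_harmRe (t : ℕ) (θ : Param K) (i : ParamIdx K) :
    partialDeriv i (harmRe t) θ = (waveGrad t θ i).re :=
  (HasDerivAt.complex_re (hasDerivAt_harmWave θ i t)).deriv

theorem partialDeriv_harmIm (t : ℕ) (θ : Param K) (i : ParamIdx K) :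
    partialDeriv i (harmIm t) θ = (waveGrad t θ i).im :=
  (HasDerivAt.complex_im (hasDerivAt_harmWave θ i t)).deriv

theorem hess_harmRe (t : ℕ) (θ : Param K) (i j : ParamIdx K) :
    hess (harmRe t) θ i j = (waveHess t θ i j).re := by
  simp only [hess, Matrix.of_apply, partialDeriv_harmRe]
  exact (HasDerivAt.complex_re (hasDerivAt_waveGrad θ i j t)).deriv

theorem hess_harmIm (t : ℕ) (θ : Param K) (i j : ParamIdx K) :
    hess (harmIm t) θ i j = (waveHess t θ i j).im := by
  simp only [hess, Matrix.of_apply, partialDeriv_harmIm]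
  exact (HasDerivAt.complex_im (hasDerivAt_waveGrad θ i j t)).deriv

/-! ### First-order conditions -/

/-- Orders and sample times are integers, so reducing pitch and phases modulo 2π leaves every
waveform sample unchanged. The angular constraints are therefore void: minimisers at -π need no
special care, and competitors may have arbitrary angles. -/
theorem isMin_of_amp_pos {S : SignalModel K} {N : ℕ} {θ : Param K} (h : IsPseudoTrue S N θ)
    {η : Param K} (hη : ∀ k, 0 < amp η k) : lsCost S N θ ≤ lsCost S N η := by
  have hpi : (0 : ℝ) < 2 * Real.pi := by positivity
  let ζ : Param K := fun i => match i with
    | Sum.inl _ => toIcoMod hpi (-Real.pi) (pitch η)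
    | Sum.inr (Sum.inl k) => toIcoMod hpi (-Real.pi) (phase η k)
    | Sum.inr (Sum.inr k) => amp η k
  have hIco : ∀ x, toIcoMod hpi (-Real.pi) x ∈ Set.Ico (-Real.pi) Real.pi := fun x => by
    have := toIcoMod_mem_Ico hpi (-Real.pi) x
    rwa [show -Real.pi + 2 * Real.pi = Real.pi by ring] at this
  have hζ : ζ ∈ paramSet K := ⟨hIco _, fun k => hIco _, hη⟩
  have htone : ∀ k t, harmTone ζ k t = harmTone η k t := by
    intro k t
    have h1 : pitch ζ = pitch η - toIcoDiv hpi (-Real.pi) (pitch η) * (2 * Real.pi) := by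
      rw [← zsmul_eq_mul]; rfl
    have h2 : phase ζ k =
        phase η k - toIcoDiv hpi (-Real.pi) (phase η k) * (2 * Real.pi) := by
      rw [← zsmul_eq_mul]; rfl
    rw [harmTone, harmTone, tone, tone, h1, h2, Complex.exp_eq_exp_iff_exists_int]
    refine ⟨-toIcoDiv hpi (-Real.pi) (phase η k) -
      ((k : ℕ) + 1) * toIcoDiv hpi (-Real.pi) (pitch η) * t, ?_⟩
    simp only [order]
    push_cast
    ring
  have hw : ∀ t, harmWave t ζ = harmWave t η := fun t => by
    rw [harmWave_eq, harmWave_eq]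
    exact Finset.sum_congr rfl fun k _ => by rw [htone]; rfl
  have := h.2 hζ
  simpa only [lsCost, hw, Set.mem_ofPred_eq] using this

theorem sum_norm_sq_le {S : SignalModel K} {N : ℕ} {θ : Param K} (h : IsPseudoTrue S N θ)
    {η : Param K} (hη : ∀ k, 0 < amp η k) :
    ∑ t ∈ Finset.range N, ‖S.wave t - harmWave t θ‖ ^ 2 ≤
      ∑ t ∈ Finset.range N, ‖S.wave t - harmWave t η‖ ^ 2 := by
  rcases Nat.eq_zero_or_pos N with rfl | hN
  · simp
  · have := isMin_of_amp_pos h hη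
    rw [lsCost, lsCost] at this
    have hN' : (0 : ℝ) < 1 / N := by positivity
    exact le_of_mul_le_mul_left this hN'

theorem sum_conj_waveDiff_mul_waveGrad {S : SignalModel K} {N : ℕ} {θ : Param K}
    (h : IsPseudoTrue S N θ) (i : ParamIdx K) :
    (∑ t ∈ Finset.range N, conj (waveDiff S t θ) * waveGrad t θ i).re = 0 := by
  have hQ : HasDerivAt (fun u => ∑ t ∈ Finset.range N,
      ‖S.wave t - harmWave t (Function.update θ i u)‖ ^ 2)
      (∑ t ∈ Finset.range N, 2 * (conj (waveDiff S t θ) * waveGrad t θ i).re) (θ i) := by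
    refine HasDerivAt.fun_sum fun t _ => ?_
    have h1 := (hasDerivAt_harmWave θ i t).const_sub (S.wave t)
    have h2 := (HasDerivAt.complex_re h1).pow 2
    have h3 := (HasDerivAt.complex_im h1).pow 2
    have h4 := h2.add h3
    convert h4 using 1
    · ext u
      rw [Complex.sq_norm, Complex.normSq_apply]
      simp only [Pi.add_apply, Pi.pow_apply]
      ring
    · rw [Function.update_eq_self]
      simp only [waveDiff, map_sub, Complex.mul_re, Complex.sub_re, Complex.conj_re,
        Complex.sub_im, Complex.conj_im, Complex.neg_re, Complex.neg_im]
      push_cast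
      ring
  -- Only positivity of the amplitudes restricts the competitors, and this is an open condition.
  have hmin : IsLocalMin (fun u => ∑ t ∈ Finset.range N,
      ‖S.wave t - harmWave t (Function.update θ i u)‖ ^ 2) (θ i) := by
    have hev : ∀ᶠ u in 𝓝 (θ i), ∀ k, 0 < amp (Function.update θ i u) k := by
      refine Filter.eventually_all.2 fun k => ?_
      have hc : ContinuousAt (fun u => Function.update θ i u (Sum.inr (Sum.inr k))) (θ i) :=
        (hasDerivAt_update_apply θ i _).continuousAt
      refine hc.eventually (lt_mem_nhds ?_)
      beta_reduce
      rw [Function.update_eq_self]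
      exact h.1.2.2 k
    filter_upwards [hev] with u hu
    have := sum_norm_sq_le h hu
    simpa only [Function.update_eq_self] using this
  have h0 := hmin.hasDerivAt_eq_zero hQ
  rw [← Finset.mul_sum, ← Complex.re_sum] at h0
  linarith

theorem waveGrad_pitch (t : ℕ) (θ : Param K) : waveGrad t θ (Sum.inl ()) =
    ∑ k, Complex.I * (order k * amp θ k * t : ℝ) * harmTone θ k t := by
  simp only [waveGrad, ampRate, argRate]
  refine Finset.sum_congr rfl fun k _ => ?_
  simp
  left
  ring

theorem waveGrad_phase (t : ℕ) (θ : Param K) (k : Fin K) :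
    waveGrad t θ (Sum.inr (Sum.inl k)) = Complex.I * amp θ k * harmTone θ k t := by
  simp only [waveGrad, ampRate, argRate]
  rw [Finset.sum_eq_single k]
  · simp
    left
    ring
  · intro l _ hl
    simp [Ne.symm hl]
  · simp

theorem waveGrad_amp (t : ℕ) (θ : Param K) (k : Fin K) :
    waveGrad t θ (Sum.inr (Sum.inr k)) = harmTone θ k t := by
  simp only [waveGrad, ampRate, argRate]
  rw [Finset.sum_eq_single k]
  · simp
  · intro l _ hl
    simp [Ne.symm hl]
  · simp

/-- The weighted correlation `∑_t t^j conj(δ_t) e_k(t)` of the waveform difference with a tone. -/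
def resid (S : SignalModel K) (j N : ℕ) (θ : Param K) (k : Fin K) : ℂ :=
  ∑ t ∈ Finset.range N, (t : ℂ) ^ j * (conj (waveDiff S t θ) * harmTone θ k t)

/-- Stationarity in the amplitude kills the real part. Stationarity in the phase kills the imaginary
part multiplied by r_k, and r_k is positive. -/
theorem resid_zero_eq_zero {S : SignalModel K} {N : ℕ} {θ : Param K}
    (h : IsPseudoTrue S N θ) (k : Fin K) : resid S 0 N θ k = 0 := by
  have h1 := sum_conj_waveDiff_mul_waveGrad h (Sum.inr (Sum.inl k))
  have h2 := sum_conj_waveDiff_mul_waveGrad h (Sum.inr (Sum.inr k))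
  simp only [waveGrad_amp] at h2
  have hr : resid S 0 N θ k =
      ∑ t ∈ Finset.range N, conj (waveDiff S t θ) * harmTone θ k t := by
    simp [resid]
  rw [← hr] at h2
  have h3 : ∑ t ∈ Finset.range N, conj (waveDiff S t θ) * waveGrad t θ (Sum.inr (Sum.inl k)) =
      Complex.I * amp θ k * resid S 0 N θ k := by
    rw [hr, Finset.mul_sum]
    refine Finset.sum_congr rfl fun t _ => ?_
    rw [waveGrad_phase]
    ring
  rw [h3] at h1
  have h4 := h.1.2.2 k
  apply Complex.ext
  · exact h2
  · simp [Complex.mul_re] at h1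
    simpa [h4.ne'] using h1

end

/-! ### Schur complements -/

section
open Matrix
variable {n : Type*}

/-- The symmetric matrix on `Unit ⊕ n` with corner `p`, border `v` and block `B`, where the
coordinates in `n` are rescaled by `τ`. -/
def bordered (τ : n → ℝ) (p : ℝ) (v : n → ℝ) (B : Matrix n n ℝ) :
    Matrix (Unit ⊕ n) (Unit ⊕ n) ℝ :=
  Matrix.fromBlocks (Matrix.of fun _ _ => p) (Matrix.of fun _ j => τ j * v j)
    (Matrix.of fun i _ => τ i * v i) (Matrix.of fun i j => τ i * τ j * B i j)

theorem bordered_isSymm (τ : n → ℝ) (p : ℝ) (v : n → ℝ) {B : Matrix n n ℝ} (hB : B.IsSymm) :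
    (bordered τ p v B).IsSymm := by
  ext i j
  rcases i with i | i <;> rcases j with j | j <;> simp [bordered]
  rw [hB.apply, mul_comm (τ i)]

variable [Fintype n]

theorem bordered_mulVec_inl (τ : n → ℝ) (p : ℝ) (v : n → ℝ) (B : Matrix n n ℝ)
    (x : Unit ⊕ n → ℝ) :
    (bordered τ p v B *ᵥ x) (Sum.inl ()) =
      p * x (Sum.inl ()) + v ⬝ᵥ fun i => τ i * x (Sum.inr i) := by
  simp only [Matrix.mulVec, dotProduct, bordered, Fintype.sum_sum_type, Matrix.fromBlocks_apply₁₁,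
    Matrix.fromBlocks_apply₁₂, Matrix.of_apply, Finset.univ_unique, Finset.sum_singleton]
  congr 1
  exact Finset.sum_congr rfl fun i _ => by ring

theorem bordered_mulVec_inr (τ : n → ℝ) (p : ℝ) (v : n → ℝ) (B : Matrix n n ℝ)
    (x : Unit ⊕ n → ℝ) (i : n) :
    (bordered τ p v B *ᵥ x) (Sum.inr i) =
      τ i * (x (Sum.inl ()) * v i + (B *ᵥ fun j => τ j * x (Sum.inr j)) i) := by
  simp only [Matrix.mulVec, dotProduct, bordered, Fintype.sum_sum_type, Matrix.fromBlocks_apply₂₁,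
    Matrix.fromBlocks_apply₂₂, Matrix.of_apply, Finset.univ_unique, Finset.sum_singleton, mul_add, Finset.mul_sum]
  congr 1
  · ring
  · exact Finset.sum_congr rfl fun i _ => by ring

variable [DecidableEq n]

/-- Block elimination: a kernel vector has rescaled lower part -x₀w, which leaves x₀(p - v·w) = 0 in
the first row. -/
theorem isUnit_det_bordered {τ : n → ℝ} (hτ : ∀ i, τ i ≠ 0) {p : ℝ} {v w : n → ℝ}
    {B : Matrix n n ℝ} (hB : IsUnit B.det) (hw : B *ᵥ w = v) (hm : p - v ⬝ᵥ w ≠ 0) :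
    IsUnit (bordered τ p v B).det := by
  rw [isUnit_iff_ne_zero]
  intro hdet
  obtain ⟨x, hx0, hx⟩ := Matrix.exists_mulVec_eq_zero_iff.2 hdet
  set y : n → ℝ := fun i => τ i * x (Sum.inr i) with hy
  have h1 : p * x (Sum.inl ()) + v ⬝ᵥ y = 0 := by
    rw [← bordered_mulVec_inl τ p v B x, hx]; rfl
  have h2 : B *ᵥ (x (Sum.inl ()) • w + y) = 0 := by
    ext i
    have h3 := bordered_mulVec_inr τ p v B x i
    rw [hx, Pi.zero_apply, eq_comm, mul_eq_zero, or_iff_right (hτ i)] at h3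
    rw [Matrix.mulVec_add, Matrix.mulVec_smul, hw]
    simpa using h3
  have h4 : x (Sum.inl ()) • w + y = 0 :=
    Matrix.eq_zero_of_mulVec_eq_zero (isUnit_iff_ne_zero.1 hB) h2
  have hy' : y = -(x (Sum.inl ()) • w) := eq_neg_of_add_eq_zero_right h4
  rw [hy', dotProduct_neg, dotProduct_smul, smul_eq_mul] at h1
  have h5 : x (Sum.inl ()) = 0 := by
    have : x (Sum.inl ()) * (p - v ⬝ᵥ w) = 0 := by linarith
    exact (mul_eq_zero.1 this).resolve_right hm
  rw [h5, zero_smul, neg_zero] at hy'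
  apply hx0
  ext i
  rcases i with i | i
  · exact h5
  · have := congrFun hy' i
    simpa [hy, hτ i] using this

/-- By symmetry the entry is yᵀQy, where Q is the middle matrix and y the first column of the
inverse. Since Q has the same block B, its quadratic part is w·Bw = v·w, so B⁻¹ enters only through
w. The scales τ cancel. -/
theorem inv_bordered_mul_mul_inv {τ : n → ℝ} (hτ : ∀ i, τ i ≠ 0) {p q : ℝ} {u v w : n → ℝ}
    {B : Matrix n n ℝ} (hBs : B.IsSymm) (hB : IsUnit B.det) (hw : B *ᵥ w = v)
    (hm : p - v ⬝ᵥ w ≠ 0) :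
    ((bordered τ p v B)⁻¹ * bordered τ q u B * (bordered τ p v B)⁻¹) (Sum.inl ()) (Sum.inl ()) =
      (q - 2 * (u ⬝ᵥ w) + v ⬝ᵥ w) / (p - v ⬝ᵥ w) ^ 2 := by
  set M := bordered τ p v B
  set m := p - v ⬝ᵥ w with hm_def
  have hM : IsUnit M.det := isUnit_det_bordered hτ hB hw hm
  have hMs : M.IsSymm := bordered_isSymm τ p v hBs
  -- Block elimination gives this as the first column of M⁻¹.
  let y : Unit ⊕ n → ℝ := Sum.elim (fun _ => 1 / m) fun i => -(w i / (m * τ i))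
  have hty : (fun i => τ i * y (Sum.inr i)) = -(1 / m) • w := by
    ext i
    simp only [y, Sum.elim_inr, Pi.smul_apply, smul_eq_mul]
    field_simp [hτ i]
  have hMy : M *ᵥ y = Pi.single (Sum.inl ()) 1 := by
    ext i
    rcases i with i | i
    · rw [bordered_mulVec_inl, hty, dotProduct_smul]
      simp only [y, Sum.elim_inl, smul_eq_mul, Pi.single_eq_same]
      field_simp
      rw [hm_def]
      ring
    · rw [bordered_mulVec_inr, hty, Matrix.mulVec_smul, hw]
      simp [y]
  have hinv : M⁻¹ *ᵥ Pi.single (Sum.inl ()) 1 = y := by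
    rw [← hMy, Matrix.mulVec_mulVec, Matrix.nonsing_inv_mul _ hM, Matrix.one_mulVec]
  have hcol : ∀ i, M⁻¹ i (Sum.inl ()) = y i := fun i => by
    rw [← hinv]; simp
  have hrow : ∀ i, M⁻¹ (Sum.inl ()) i = y i := fun i => by
    rw [← hcol, ← Matrix.transpose_apply M⁻¹, Matrix.transpose_nonsing_inv, hMs.eq]
  have hentry : (M⁻¹ * bordered τ q u B * M⁻¹) (Sum.inl ()) (Sum.inl ()) =
      y ⬝ᵥ (bordered τ q u B *ᵥ y) := by
    rw [Matrix.mul_assoc, Matrix.mul_apply]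
    refine Finset.sum_congr rfl fun i _ => ?_
    rw [hrow, Matrix.mul_apply]
    congr 1
    exact Finset.sum_congr rfl fun j _ => by rw [hcol]
  rw [hentry, dotProduct, Fintype.sum_sum_type]
  simp only [Finset.univ_unique, Finset.sum_singleton]
  have h1 : (bordered τ q u B *ᵥ y) (Sum.inl ()) = (q - u ⬝ᵥ w) / m := by
    rw [bordered_mulVec_inl, hty, dotProduct_smul]
    simp only [y, Sum.elim_inl, smul_eq_mul]
    ring
  have h2 : ∀ i, (bordered τ q u B *ᵥ y) (Sum.inr i) = τ i * ((u i - v i) / m) := fun i => by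
    rw [bordered_mulVec_inr, hty, Matrix.mulVec_smul, hw]
    simp only [y, Sum.elim_inl, Pi.smul_apply, smul_eq_mul]
    ring
  have h3 : ∑ i, y (Sum.inr i) * (bordered τ q u B *ᵥ y) (Sum.inr i) =
      (v ⬝ᵥ w - u ⬝ᵥ w) / m ^ 2 := by
    rw [← sub_dotProduct, dotProduct, Finset.sum_div]
    refine Finset.sum_congr rfl fun i _ => ?_
    rw [h2]
    simp only [y, Sum.elim_inr, Pi.sub_apply]
    field_simp [hτ i]
    ring
  rw [h3, show (default : Unit) = () from rfl, h1]
  simp only [y, Sum.elim_inl]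
  field_simp
  ring

end

/-! ### The matrices in terms of correlations -/

section
open Matrix
variable {K : ℕ}

/-- The correlation `∑_t t^j conj(e_k(t)) e_l(t)` of two tones of the harmonic model. -/
def gram (j N : ℕ) (θ : Param K) (k l : Fin K) : ℂ :=
  ∑ t ∈ Finset.range N, (t : ℂ) ^ j * (conj (harmTone θ k t) * harmTone θ l t)

theorem gram_conj (j N : ℕ) (θ : Param K) (k l : Fin K) :
    conj (gram j N θ k l) = gram j N θ l k := by
  rw [gram, gram, map_sum]
  refine Finset.sum_congr rfl fun t _ => ?_
  simp only [map_mul, map_pow, Complex.conj_natCast, Complex.conj_conj]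
  ring

/-- The scale factors `(r_1, …, r_K, 1, …, 1)` of the nuisance parameters. -/
def nuisScale (θ : Param K) : Fin K ⊕ Fin K → ℝ := Sum.elim (fun k => amp θ k) fun _ => 1

/-- The block of the rescaled Gram matrix that belongs to the nuisance parameters. -/
def nuisBlock (N : ℕ) (θ : Param K) : Matrix (Fin K ⊕ Fin K) (Fin K ⊕ Fin K) ℝ :=
  Matrix.fromBlocks (Matrix.of fun k l => (gram 0 N θ k l).re)
    (Matrix.of fun k l => (gram 0 N θ k l).im) (Matrix.of fun k l => -(gram 0 N θ k l).im)
    (Matrix.of fun k l => (gram 0 N θ k l).re)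

theorem nuisBlock_isSymm (N : ℕ) (θ : Param K) : (nuisBlock N θ).IsSymm := by
  ext i j
  rcases i with i | i <;> rcases j with j | j <;> simp [nuisBlock] <;>
    rw [← gram_conj] <;> simp

/-- The corner of the Gram matrix. -/
def gramCorner (N : ℕ) (θ : Param K) : ℝ :=
  ∑ k, ∑ l, order k * amp θ k * (order l * amp θ l) * (gram 2 N θ k l).re

/-- The border of the rescaled Gram matrix. -/
def gramBorder (N : ℕ) (θ : Param K) : Fin K ⊕ Fin K → ℝ :=
  Sum.elim (fun k => ∑ l, order l * amp θ l * (gram 1 N θ l k).re)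
    fun k => ∑ l, order l * amp θ l * (gram 1 N θ l k).im

/-- The corner of the curvature matrix. -/
def curvCorner (S : SignalModel K) (N : ℕ) (θ : Param K) : ℝ :=
  -∑ k, order k ^ 2 * amp θ k * (resid S 2 N θ k).re

/-- The border of the rescaled curvature matrix. -/
def curvBorder (S : SignalModel K) (N : ℕ) (θ : Param K) : Fin K ⊕ Fin K → ℝ :=
  Sum.elim (fun k => -(order k * (resid S 1 N θ k).re)) fun k => -(order k * (resid S 1 N θ k).im)

/-- The entries are real parts of ∑ conj(∂ᵢμ) ∂ⱼμ. Every phase derivative carries a factor i r_k: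
its modulus goes into `nuisScale`, and the factor i turns real parts of correlations into imaginary
parts in the mixed blocks. -/
theorem gramMatrix_eq (N : ℕ) (θ : Param K) :
    ∑ t ∈ Finset.range N, (vecMulVec (grad (harmRe t) θ) (grad (harmRe t) θ) +
      vecMulVec (grad (harmIm t) θ) (grad (harmIm t) θ)) =
    bordered (nuisScale θ) (gramCorner N θ) (gramBorder N θ) (nuisBlock N θ) := by
  have key : ∀ i j, (∑ t ∈ Finset.range N, (vecMulVec (grad (harmRe t) θ) (grad (harmRe t) θ) +
      vecMulVec (grad (harmIm t) θ) (grad (harmIm t) θ))) i j =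
      (∑ t ∈ Finset.range N, conj (waveGrad t θ i) * waveGrad t θ j).re := fun i j => by
    rw [Matrix.sum_apply, Complex.re_sum]
    refine Finset.sum_congr rfl fun t _ => ?_
    simp only [Matrix.add_apply, vecMulVec_apply, grad, partialDeriv_harmRe, partialDeriv_harmIm,
      Complex.mul_re, Complex.conj_re, Complex.conj_im]
    ring
  have hc : ∀ i j, (∑ t ∈ Finset.range N, conj (waveGrad t θ i) * waveGrad t θ j).re =
      (∑ t ∈ Finset.range N, conj (waveGrad t θ j) * waveGrad t θ i).re := fun i j => by
    rw [Complex.re_sum, Complex.re_sum]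
    refine Finset.sum_congr rfl fun t _ => ?_
    simp only [Complex.mul_re, Complex.conj_re, Complex.conj_im]
    ring
  have hphase : ∀ k, (∑ t ∈ Finset.range N, conj (waveGrad t θ (Sum.inl ())) *
      waveGrad t θ (Sum.inr (Sum.inl k))).re = amp θ k * gramBorder N θ (Sum.inl k) := fun k => by
    have : ∑ t ∈ Finset.range N, conj (waveGrad t θ (Sum.inl ())) *
        waveGrad t θ (Sum.inr (Sum.inl k)) =
        ∑ l, ((amp θ k * (order l * amp θ l) : ℝ) : ℂ) * gram 1 N θ l k := by
      simp only [waveGrad_pitch, waveGrad_phase, gram, map_sum, Finset.sum_mul, Finset.mul_sum]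
      rw [Finset.sum_comm]
      refine Finset.sum_congr rfl fun l _ => Finset.sum_congr rfl fun t _ => ?_
      simp only [map_mul, Complex.conj_I, Complex.conj_ofReal]
      push_cast
      linear_combination (-(order l * amp θ l * t * amp θ k *
        (conj (harmTone θ l t) * harmTone θ k t) : ℂ)) * Complex.I_mul_I
    rw [this, gramBorder, Sum.elim_inl, Complex.re_sum, Finset.mul_sum]
    refine Finset.sum_congr rfl fun l _ => ?_
    rw [Complex.re_ofReal_mul]
    ring
  have hamp : ∀ k, (∑ t ∈ Finset.range N, conj (waveGrad t θ (Sum.inl ())) *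
      waveGrad t θ (Sum.inr (Sum.inr k))).re = gramBorder N θ (Sum.inr k) := fun k => by
    have : ∑ t ∈ Finset.range N, conj (waveGrad t θ (Sum.inl ())) *
        waveGrad t θ (Sum.inr (Sum.inr k)) =
        ∑ l, ((order l * amp θ l : ℝ) : ℂ) * (-Complex.I * gram 1 N θ l k) := by
      simp only [waveGrad_pitch, waveGrad_amp, gram, map_sum, Finset.sum_mul, Finset.mul_sum]
      rw [Finset.sum_comm]
      refine Finset.sum_congr rfl fun l _ => Finset.sum_congr rfl fun t _ => ?_
      simp only [map_mul, Complex.conj_I, Complex.conj_ofReal]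
      push_cast
      ring
    rw [this, gramBorder, Sum.elim_inr, Complex.re_sum]
    refine Finset.sum_congr rfl fun l _ => ?_
    rw [Complex.re_ofReal_mul]
    simp
  ext i j
  rw [key]
  rcases i with ⟨⟩ | k | k <;> rcases j with ⟨⟩ | l | l
  · have : ∑ t ∈ Finset.range N, conj (waveGrad t θ (Sum.inl ())) * waveGrad t θ (Sum.inl ()) =
        ∑ k, ∑ l, ((order k * amp θ k * (order l * amp θ l) : ℝ) : ℂ) * gram 2 N θ k l := by
      simp only [waveGrad_pitch, gram, map_sum, Finset.sum_mul, Finset.mul_sum]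
      rw [Finset.sum_comm]
      refine (Finset.sum_congr rfl fun k _ => Finset.sum_comm).trans ?_
      refine Finset.sum_comm.trans (Finset.sum_congr rfl fun k _ => Finset.sum_congr rfl fun l _ =>
        Finset.sum_congr rfl fun t _ => ?_)
      simp only [map_mul, Complex.conj_I, Complex.conj_ofReal]
      push_cast
      linear_combination (-(order k * amp θ k * t * order l * amp θ l * t *
        (conj (harmTone θ k t) * harmTone θ l t) : ℂ)) * Complex.I_mul_I
    rw [this]
    simp only [bordered, Matrix.fromBlocks_apply₁₁, Matrix.of_apply, gramCorner, Complex.re_sum,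
      Complex.re_ofReal_mul]
  · exact hphase l
  · rw [hamp]
    simp [bordered, nuisScale]
  · rw [hc]
    exact hphase k
  · have : ∑ t ∈ Finset.range N, conj (waveGrad t θ (Sum.inr (Sum.inl k))) *
        waveGrad t θ (Sum.inr (Sum.inl l)) = ((amp θ k * amp θ l : ℝ) : ℂ) * gram 0 N θ k l := by
      simp only [waveGrad_phase, gram, Finset.mul_sum]
      refine Finset.sum_congr rfl fun t _ => ?_
      simp only [map_mul, Complex.conj_I, Complex.conj_ofReal]
      push_cast
      linear_combination (-(amp θ k * amp θ l *
        (conj (harmTone θ k t) * harmTone θ l t) : ℂ)) * Complex.I_mul_I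
    rw [this, Complex.re_ofReal_mul]
    rfl
  · have : ∑ t ∈ Finset.range N, conj (waveGrad t θ (Sum.inr (Sum.inl k))) *
        waveGrad t θ (Sum.inr (Sum.inr l)) = (amp θ k : ℂ) * (-Complex.I * gram 0 N θ k l) := by
      simp only [waveGrad_phase, waveGrad_amp, gram, Finset.mul_sum]
      refine Finset.sum_congr rfl fun t _ => ?_
      simp only [map_mul, Complex.conj_I, Complex.conj_ofReal]
      ring
    rw [this, Complex.re_ofReal_mul]
    simp [bordered, nuisScale, nuisBlock]
  · rw [hc, hamp]
    simp [bordered, nuisScale]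
  · have : ∑ t ∈ Finset.range N, conj (waveGrad t θ (Sum.inr (Sum.inr k))) *
        waveGrad t θ (Sum.inr (Sum.inl l)) = (amp θ l : ℂ) * (Complex.I * gram 0 N θ k l) := by
      simp only [waveGrad_phase, waveGrad_amp, gram, Finset.mul_sum]
      refine Finset.sum_congr rfl fun t _ => ?_
      ring
    rw [this, Complex.re_ofReal_mul]
    simp [bordered, nuisScale, nuisBlock]
  · have : ∑ t ∈ Finset.range N, conj (waveGrad t θ (Sum.inr (Sum.inr k))) *
        waveGrad t θ (Sum.inr (Sum.inr l)) = gram 0 N θ k l := by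
      simp only [waveGrad_amp, gram]
      refine Finset.sum_congr rfl fun t _ => ?_
      ring
    rw [this]
    simp [bordered, nuisScale, nuisBlock]

theorem sum_conj_waveDiff_mul_waveHess_pitch (S : SignalModel K) (N : ℕ) (θ : Param K) :
    (∑ t ∈ Finset.range N, conj (waveDiff S t θ) * waveHess t θ (Sum.inl ()) (Sum.inl ())).re =
      curvCorner S N θ := by
  have : ∑ t ∈ Finset.range N, conj (waveDiff S t θ) * waveHess t θ (Sum.inl ()) (Sum.inl ()) =
      ∑ k, ((-(order k ^ 2 * amp θ k) : ℝ) : ℂ) * resid S 2 N θ k := by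
    simp only [waveHess, resid, Finset.mul_sum]
    rw [Finset.sum_comm]
    refine Finset.sum_congr rfl fun k _ => Finset.sum_congr rfl fun t _ => ?_
    simp [ampRate, argRate]
    ring
  rw [this, Complex.re_sum, curvCorner, ← Finset.sum_neg_distrib]
  refine Finset.sum_congr rfl fun k _ => ?_
  rw [Complex.re_ofReal_mul]
  ring

theorem waveHess_comm (t : ℕ) (θ : Param K) (i j : ParamIdx K) :
    waveHess t θ i j = waveHess t θ j i :=
  Finset.sum_congr rfl fun k _ => by ring

theorem sum_conj_waveDiff_mul_waveHess_phase (S : SignalModel K) (N : ℕ) (θ : Param K)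
    (k : Fin K) :
    (∑ t ∈ Finset.range N, conj (waveDiff S t θ) *
      waveHess t θ (Sum.inl ()) (Sum.inr (Sum.inl k))).re =
      amp θ k * curvBorder S N θ (Sum.inl k) := by
  have : ∑ t ∈ Finset.range N, conj (waveDiff S t θ) *
      waveHess t θ (Sum.inl ()) (Sum.inr (Sum.inl k)) =
      ((-(order k * amp θ k) : ℝ) : ℂ) * resid S 1 N θ k := by
    simp only [waveHess, resid, Finset.mul_sum]
    refine Finset.sum_congr rfl fun t _ => ?_
    rw [Finset.sum_eq_single k]
    · simp [ampRate, argRate]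
      ring
    · intro l _ hl
      simp [ampRate, argRate, Ne.symm hl]
    · simp
  rw [this, Complex.re_ofReal_mul, curvBorder, Sum.elim_inl]
  ring

theorem sum_conj_waveDiff_mul_waveHess_amp (S : SignalModel K) (N : ℕ) (θ : Param K)
    (k : Fin K) :
    (∑ t ∈ Finset.range N, conj (waveDiff S t θ) *
      waveHess t θ (Sum.inl ()) (Sum.inr (Sum.inr k))).re =
      curvBorder S N θ (Sum.inr k) := by
  have : ∑ t ∈ Finset.range N, conj (waveDiff S t θ) *
      waveHess t θ (Sum.inl ()) (Sum.inr (Sum.inr k)) =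
      (order k : ℂ) * (Complex.I * resid S 1 N θ k) := by
    simp only [waveHess, resid, Finset.mul_sum]
    refine Finset.sum_congr rfl fun t _ => ?_
    rw [Finset.sum_eq_single k]
    · simp [ampRate, argRate]
      ring
    · intro l _ hl
      simp [ampRate, argRate, Ne.symm hl]
    · simp
  rw [this, Complex.re_ofReal_mul, curvBorder, Sum.elim_inr]
  simp

/-- Without a pitch derivative no factor t appears, so the second derivative is a combination of the
tones with coefficients independent of t (hence evaluated at t = 0). The residual is orthogonal to
each tone. -/
theorem sum_conj_waveDiff_mul_waveHess_nuis {S : SignalModel K} {N : ℕ} {θ : Param K}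
    (h : IsPseudoTrue S N θ) (i j : Fin K ⊕ Fin K) :
    ∑ t ∈ Finset.range N, conj (waveDiff S t θ) * waveHess t θ (Sum.inr i) (Sum.inr j) = 0 := by
  have : ∃ z : Fin K → ℂ, ∀ t, waveHess t θ (Sum.inr i) (Sum.inr j) =
      ∑ k, z k * harmTone θ k t := by
    refine ⟨fun k => ampRate (Sum.inr i) k * (Complex.I * argRate (Sum.inr j) k 0) +
      ampRate (Sum.inr j) k * (Complex.I * argRate (Sum.inr i) k 0) -
      amp θ k * (argRate (Sum.inr i) k 0 * argRate (Sum.inr j) k 0), fun t => ?_⟩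
    simp [waveHess, argRate]
  obtain ⟨z, hz⟩ := this
  simp only [hz, Finset.mul_sum]
  rw [Finset.sum_comm]
  refine Finset.sum_eq_zero fun k _ => ?_
  have h1 := resid_zero_eq_zero h k
  rw [resid] at h1
  rw [← mul_zero (z k), ← h1, Finset.mul_sum]
  refine Finset.sum_congr rfl fun t _ => ?_
  rw [pow_zero]
  ring

theorem curvMatrix_eq {S : SignalModel K} {N : ℕ} {θ : Param K} (h : IsPseudoTrue S N θ) :
    ∑ t ∈ Finset.range N, ((waveDiff S t θ).re • hess (harmRe t) θ +
      (waveDiff S t θ).im • hess (harmIm t) θ) =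
    bordered (nuisScale θ) (curvCorner S N θ) (curvBorder S N θ) 0 := by
  ext i j
  have key : (∑ t ∈ Finset.range N, ((waveDiff S t θ).re • hess (harmRe t) θ +
      (waveDiff S t θ).im • hess (harmIm t) θ)) i j =
      (∑ t ∈ Finset.range N, conj (waveDiff S t θ) * waveHess t θ i j).re := by
    rw [Matrix.sum_apply, Complex.re_sum]
    refine Finset.sum_congr rfl fun t _ => ?_
    simp only [Matrix.add_apply, Matrix.smul_apply, smul_eq_mul, hess_harmRe, hess_harmIm,
      Complex.mul_re, Complex.conj_re, Complex.conj_im]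
    ring
  rw [key]
  rcases i with ⟨⟩ | i <;> rcases j with ⟨⟩ | j
  · exact sum_conj_waveDiff_mul_waveHess_pitch S N θ
  · rcases j with k | k
    · exact sum_conj_waveDiff_mul_waveHess_phase S N θ k
    · rw [sum_conj_waveDiff_mul_waveHess_amp]
      simp [bordered, nuisScale]
  · simp only [waveHess_comm _ _ (Sum.inr i)]
    rcases i with k | k
    · exact sum_conj_waveDiff_mul_waveHess_phase S N θ k
    · rw [sum_conj_waveDiff_mul_waveHess_amp]
      simp [bordered, nuisScale]
  · rw [sum_conj_waveDiff_mul_waveHess_nuis h]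
    simp [bordered]

theorem bordered_add (τ : Fin K ⊕ Fin K → ℝ) (p q : ℝ) (u v : Fin K ⊕ Fin K → ℝ)
    (B : Matrix (Fin K ⊕ Fin K) (Fin K ⊕ Fin K) ℝ) :
    bordered τ p u B + bordered τ q v 0 = bordered τ (p + q) (u + v) B := by
  ext i j
  rcases i with i | i <;> rcases j with j | j <;> simp [bordered, mul_add]

theorem pseudoVar_pos {S : SignalModel K} {s : ℝ} (hs : 0 < s) (N : ℕ) (θ : Param K) :
    0 < pseudoVar S s N θ := by
  rw [pseudoVar]
  positivity

theorem matF_eq (S : SignalModel K) (s : ℝ) (N : ℕ) (θ : Param K) :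
    matF S s N θ = (2 * s / pseudoVar S s N θ ^ 2) •
      bordered (nuisScale θ) (gramCorner N θ) (gramBorder N θ) (nuisBlock N θ) := by
  rw [matF, gramMatrix_eq]

theorem matA_eq {S : SignalModel K} {s : ℝ} (hs : 0 < s) {N : ℕ} {θ : Param K}
    (h : IsPseudoTrue S N θ) :
    matA S s N θ = (-(2 / pseudoVar S s N θ)) •
      bordered (nuisScale θ) (gramCorner N θ + curvCorner S N θ)
        (gramBorder N θ + curvBorder S N θ) (nuisBlock N θ) := by
  have hσ := (pseudoVar_pos (S := S) hs N θ).ne'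
  rw [← bordered_add, matA, matF_eq, matFtilde, curvMatrix_eq h, smul_smul, smul_add, neg_smul,
    neg_smul, ← sub_eq_add_neg]
  congr 3
  field_simp

/-- The scalar factors combine to (σ²/2)² · 2s/σ⁴ = s/2. The vector w is left free so that no
explicit inverse of the block is involved. -/
theorem mcrlbPitch_eq {S : SignalModel K} {s : ℝ} (hs : 0 < s) {N : ℕ} {θ : Param K}
    (h : IsPseudoTrue S N θ) {w : Fin K ⊕ Fin K → ℝ} (hB : IsUnit (nuisBlock N θ).det)
    (hw : nuisBlock N θ *ᵥ w = gramBorder N θ + curvBorder S N θ)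
    (hm : gramCorner N θ + curvCorner S N θ - (gramBorder N θ + curvBorder S N θ) ⬝ᵥ w ≠ 0) :
    IsUnit (matA S s N θ).det ∧ mcrlbPitch S s N θ =
      s / 2 * ((gramCorner N θ - 2 * (gramBorder N θ ⬝ᵥ w) +
        (gramBorder N θ + curvBorder S N θ) ⬝ᵥ w) /
        (gramCorner N θ + curvCorner S N θ - (gramBorder N θ + curvBorder S N θ) ⬝ᵥ w) ^ 2) := by
  have hσ := (pseudoVar_pos (S := S) hs N θ).ne'
  have hτ : ∀ i, nuisScale θ i ≠ 0 := by
    rintro (k | k)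
    · exact (h.1.2.2 k).ne'
    · exact one_ne_zero
  have h1 := isUnit_det_bordered hτ hB hw hm
  have h2 := inv_bordered_mul_mul_inv (q := gramCorner N θ) (u := gramBorder N θ) hτ
    (nuisBlock_isSymm N θ) hB hw hm
  have ha : IsUnit (-(2 / pseudoVar S s N θ)) :=
    isUnit_iff_ne_zero.2 (neg_ne_zero.2 (div_ne_zero two_ne_zero hσ))
  constructor
  · rw [matA_eq hs h, Matrix.det_smul]
    exact (ha.pow _).mul h1
  · rw [mcrlbPitch, matA_eq hs h, matF_eq]
    let := invertibleOfNonzero ha.ne_zero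
    rw [Matrix.inv_smul _ _ h1, invOf_eq_inv, ← h2]
    simp only [Matrix.smul_mul, Matrix.mul_smul, Matrix.smul_apply, smul_eq_mul]
    field_simp

end

/-! ### Powers of the sample size as a scale -/

section
variable {X : Type*} {l : Filter X} {N : X → ℕ}

theorem isBigO_pow_mono (hN : Tendsto N l atTop) {E : Type*} [Norm E] {f : X → E} {a b : ℕ}
    (hab : a ≤ b) (hf : f =O[l] fun x => (N x : ℝ) ^ a) : f =O[l] fun x => (N x : ℝ) ^ b := by
  refine hf.trans (IsBigO.of_bound 1 ?_)
  filter_upwards [hN.eventually_ge_atTop 1] with x hx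
  have h1 : (1 : ℝ) ≤ N x := by exact_mod_cast hx
  rw [one_mul, Real.norm_of_nonneg (by positivity), Real.norm_of_nonneg (by positivity)]
  exact pow_le_pow_right₀ h1 hab

theorem isBigO_pow_mul {f g : X → ℝ} {a b : ℕ} (hf : f =O[l] fun x => (N x : ℝ) ^ a)
    (hg : g =O[l] fun x => (N x : ℝ) ^ b) :
    (fun x => f x * g x) =O[l] fun x => (N x : ℝ) ^ (a + b) := by
  simp only [pow_add]
  exact hf.mul hg

theorem isBigO_pow_div (hN : Tendsto N l atTop) {f : X → ℝ} {a : ℕ}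
    (hf : f =O[l] fun x => (N x : ℝ) ^ (a + 1)) :
    (fun x => f x / N x) =O[l] fun x => (N x : ℝ) ^ a := by
  have h := hf.mul (isBigO_refl (fun x => (N x : ℝ)⁻¹) l)
  refine (h.congr' (Eventually.of_forall fun x => (div_eq_mul_inv _ _).symm) ?_)
  filter_upwards [hN.eventually_ge_atTop 1] with x hx
  have h1 : (N x : ℝ) ≠ 0 := by
    have : 0 < N x := hx
    positivity
  rw [pow_succ, mul_assoc, mul_inv_cancel₀ h1, mul_one]

theorem isBigO_re {f : X → ℂ} {g : X → ℝ} (hf : f =O[l] g) : (fun x => (f x).re) =O[l] g :=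
  (IsBigO.of_norm_le fun x => Complex.abs_re_le_norm (f x)).trans hf.norm_left

theorem isBigO_im {f : X → ℂ} {g : X → ℝ} (hf : f =O[l] g) : (fun x => (f x).im) =O[l] g :=
  (IsBigO.of_norm_le fun x => Complex.abs_im_le_norm (f x)).trans hf.norm_left

theorem isBigO_pow_zero_const (b : ℝ) : (fun _ => b) =O[l] fun x => (N x : ℝ) ^ 0 := by
  simpa only [pow_zero] using isBigO_const_const b one_ne_zero l

/-- The difference of two products is controlled by the differences of the factors. -/
theorem isBigO_mul_sub_mul {f f' g g' : X → ℝ} {a b : ℕ}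
    (hf : f =O[l] fun x => (N x : ℝ) ^ (a + 1)) (hg' : g' =O[l] fun x => (N x : ℝ) ^ (b + 1))
    (hff : (fun x => f x - f' x) =O[l] fun x => (N x : ℝ) ^ a)
    (hgg : (fun x => g x - g' x) =O[l] fun x => (N x : ℝ) ^ b) :
    (fun x => f x * g x - f' x * g' x) =O[l] fun x => (N x : ℝ) ^ (a + b + 1) := by
  have h1 := isBigO_pow_mul hf hgg
  have h2 := isBigO_pow_mul hff hg'
  rw [show a + 1 + b = a + b + 1 by ring] at h1
  rw [← add_assoc] at h2
  refine (h1.add h2).congr_left fun x => ?_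
  ring

end

/-! ### Perturbations of multiples of the identity -/

section
open Matrix
variable {X : Type*} {l : Filter X} {N : X → ℕ} {n : Type*} [Fintype n]

/-- Replacing w by v/N costs O(N²)·O(1) per coordinate. Replacing both borders by their leading
parts costs O(N³), which is then divided by N. -/
theorem isBigO_dotProduct_sub (hN : Tendsto N l atTop) {u v u' v' w : X → n → ℝ}
    (hu : ∀ i, (fun x => u x i) =O[l] fun x => (N x : ℝ) ^ 2)
    (hv' : ∀ i, (fun x => v' x i) =O[l] fun x => (N x : ℝ) ^ 2)
    (huu : ∀ i, (fun x => u x i - u' x i) =O[l] fun x => (N x : ℝ) ^ 1)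
    (hvv : ∀ i, (fun x => v x i - v' x i) =O[l] fun x => (N x : ℝ) ^ 1)
    (hw : ∀ i, (fun x => w x i - v x i / N x) =O[l] fun x => (N x : ℝ) ^ 0) :
    (fun x => u x ⬝ᵥ w x - (u' x ⬝ᵥ v' x) / N x) =O[l] fun x => (N x : ℝ) ^ 2 := by
  have h : ∀ i, (fun x => u x i * w x i - u' x i * v' x i / N x) =O[l]
      fun x => (N x : ℝ) ^ 2 := fun i => by
    have h1 := isBigO_pow_mul (hu i) (hw i)
    have h2 := isBigO_pow_div hN (isBigO_mul_sub_mul (hu i) (hv' i) (huu i) (hvv i))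
    refine (h1.add h2).congr_left fun x => ?_
    ring
  refine (IsBigO.fun_sum (s := Finset.univ) fun i _ => h i).congr_left fun x => ?_
  rw [Finset.sum_sub_distrib, dotProduct, dotProduct, Finset.sum_div]

variable [DecidableEq n]

/-- Diagonal dominance in the sup norm: m y is By minus (B - m·1)y. -/
theorem natCast_mul_norm_le {B : Matrix n n ℝ} {m : ℕ} {b : ℝ}
    (hB : ∀ i j, |B i j - if i = j then (m : ℝ) else 0| ≤ b) (y : n → ℝ) :
    (m : ℝ) * ‖y‖ ≤ ‖B *ᵥ y‖ + Fintype.card n * b * ‖y‖ := by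
  rcases isEmpty_or_nonempty n with hn | ⟨⟨i₀⟩⟩
  · have : y = 0 := Subsingleton.elim _ _
    simp [this]
  have hb : 0 ≤ b := (abs_nonneg _).trans (hB i₀ i₀)
  have hm : ‖(m : ℝ) • y‖ ≤ ‖B *ᵥ y‖ + Fintype.card n * b * ‖y‖ := by
    rw [pi_norm_le_iff_of_nonneg (by positivity)]
    intro i
    have h1 : ((m : ℝ) • y) i =
        (B *ᵥ y) i - ∑ j, (B i j - if i = j then (m : ℝ) else 0) * y j := by
      simp [sub_mul, Finset.sum_sub_distrib, Matrix.mulVec, dotProduct]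
    rw [h1]
    refine (norm_sub_le _ _).trans (add_le_add (norm_le_pi_norm _ i) ?_)
    refine (norm_sum_le _ _).trans ?_
    have h2 : ∀ j ∈ Finset.univ, ‖(B i j - if i = j then (m : ℝ) else 0) * y j‖ ≤ b * ‖y‖ :=
      fun j _ => by
        rw [norm_mul]
        exact mul_le_mul (hB i j) (norm_le_pi_norm y j) (norm_nonneg _) hb
    refine (Finset.sum_le_sum h2).trans ?_
    simp [mul_assoc]
  rwa [norm_smul, Real.norm_of_nonneg (Nat.cast_nonneg m)] at hm

/-- A matrix within `O(1)` of `N` times the identity is eventually invertible, and its inverse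
applied to a vector of size `O(N²)` is division by `N` up to `O(1)`. -/
theorem nearScalar_inv (hN : Tendsto N l atTop) {B : X → Matrix n n ℝ} {v : X → n → ℝ}
    (hB : ∀ i j, (fun x => B x i j - if i = j then (N x : ℝ) else 0) =O[l]
      fun x => (N x : ℝ) ^ 0)
    (hv : ∀ i, (fun x => v x i) =O[l] fun x => (N x : ℝ) ^ 2) :
    (∀ᶠ x in l, IsUnit (B x).det) ∧
      ∀ i, (fun x => ((B x)⁻¹ *ᵥ v x) i - v x i / N x) =O[l] fun x => (N x : ℝ) ^ 0 := by
  have hbd : ∃ b, ∀ᶠ x in l, ∀ i j, |B x i j - if i = j then (N x : ℝ) else 0| ≤ b := by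
    choose b hb using fun i j => (hB i j).bound
    refine ⟨∑ i, ∑ j, |b i j|, ?_⟩
    have hb' := eventually_all.2 fun i => eventually_all.2 (hb i)
    filter_upwards [hb'] with x hx i j
    have h1 := hx i j
    rw [pow_zero, norm_one, mul_one] at h1
    refine h1.trans ((le_abs_self _).trans ?_)
    have h2 : |b i j| ≤ ∑ j, |b i j| :=
      Finset.single_le_sum (f := fun j => |b i j|) (fun _ _ => abs_nonneg _) (Finset.mem_univ j)
    exact h2.trans (Finset.single_le_sum (f := fun i => ∑ j, |b i j|)
      (fun _ _ => Finset.sum_nonneg fun _ _ => abs_nonneg _) (Finset.mem_univ i))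
  obtain ⟨b, hb⟩ := hbd
  have hlarge : ∀ᶠ x in l, (1 : ℝ) ≤ N x ∧ 2 * (Fintype.card n * b) ≤ (N x : ℝ) := by
    have h := tendsto_natCast_atTop_atTop (R := ℝ).comp hN
    filter_upwards [h.eventually_ge_atTop 1, h.eventually_ge_atTop (2 * (Fintype.card n * b))]
      with x h1 h2 using ⟨h1, h2⟩
  -- Once N is at least twice the size of the perturbation, its contribution is absorbed into the
  -- left side.
  have hcoer : ∀ᶠ x in l, ∀ y : n → ℝ, (N x : ℝ) * ‖y‖ ≤ 2 * ‖B x *ᵥ y‖ := by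
    filter_upwards [hb, hlarge] with x h1 h2 y
    have h3 := natCast_mul_norm_le h1 y
    have h4 := mul_le_mul_of_nonneg_right h2.2 (norm_nonneg y)
    linarith
  have hunit : ∀ᶠ x in l, IsUnit (B x).det := by
    filter_upwards [hcoer, hlarge] with x h1 h2
    rw [isUnit_iff_ne_zero]
    intro h0
    obtain ⟨y, hy0, hy⟩ := Matrix.exists_mulVec_eq_zero_iff.2 h0
    have h3 := h1 y
    rw [hy, norm_zero, mul_zero] at h3
    have h4 : 0 < ‖y‖ := norm_pos_iff.2 hy0
    nlinarith [h2.1]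
  refine ⟨hunit, ?_⟩
  have hres : ∀ i, (fun x => ∑ j, (B x i j - if i = j then (N x : ℝ) else 0) * (v x j / N x))
      =O[l] fun x => (N x : ℝ) ^ 1 := fun i =>
    IsBigO.fun_sum fun j _ => by
      simpa using isBigO_pow_mul (hB i j) (isBigO_pow_div hN (hv j))
  -- The vector is v - Bv/N = -(B - N·1)v/N, which is O(N). Coercivity of B then removes one power
  -- of N.
  have hvec : (fun x => B x *ᵥ ((B x)⁻¹ *ᵥ v x - (N x : ℝ)⁻¹ • v x)) =O[l]
      fun x => (N x : ℝ) ^ 1 := by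
    rw [isBigO_pi]
    intro i
    refine (hres i).neg_left.congr' ?_ EventuallyEq.rfl
    filter_upwards [hunit, hlarge] with x h1 h2
    rw [Matrix.mulVec_sub, Matrix.mulVec_mulVec, Matrix.mul_nonsing_inv _ h1, Matrix.one_mulVec,
      Matrix.mulVec_smul]
    have h3 : (N x : ℝ) ≠ 0 := by linarith [h2.1]
    simp only [sub_mul, Finset.sum_sub_distrib, ite_mul, zero_mul, Finset.sum_ite_eq,
      Finset.mem_univ, if_true, Pi.sub_apply, Pi.smul_apply, smul_eq_mul, Matrix.mulVec,
      dotProduct, Finset.mul_sum]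
    rw [mul_div_cancel₀ _ h3, neg_sub]
    congr 1
    exact Finset.sum_congr rfl fun j _ => by ring
  have hsol : (fun x => (B x)⁻¹ *ᵥ v x - (N x : ℝ)⁻¹ • v x) =O[l] fun x => (N x : ℝ) ^ 0 := by
    obtain ⟨d, hd⟩ := hvec.bound
    refine IsBigO.of_bound (2 * d) ?_
    filter_upwards [hd, hcoer, hlarge] with x h1 h2 h3
    have h4 := h2 ((B x)⁻¹ *ᵥ v x - (N x : ℝ)⁻¹ • v x)
    have h5 : (0 : ℝ) < N x := by linarith [h3.1]
    rw [pow_one, Real.norm_of_nonneg h5.le] at h1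
    rw [pow_zero, norm_one, mul_one]
    refine le_of_mul_le_mul_left ?_ h5
    linarith
  intro i
  refine ((isBigO_pi.1 hsol) i).congr_left fun x => ?_
  simp only [Pi.sub_apply, Pi.smul_apply, smul_eq_mul]
  ring

end

/-! ### Correlations of almost harmonic signals -/

section
variable {K : ℕ}

/-- The correlation `∑_t t^j conj(ẽ_l(t)) e_k(t)` of a signal tone with a model tone. -/
def crossCorr (S : SignalModel K) (j N : ℕ) (θ : Param K) (l k : Fin K) : ℂ :=
  ∑ t ∈ Finset.range N, (t : ℂ) ^ j * (conj (sigTone S l t) * harmTone θ k t)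

theorem gram_eq_oscSum (j N : ℕ) (θ : Param K) (k l : Fin K) :
    gram j N θ k l = oscSum j N (phase θ l - phase θ k) (order l * pitch θ - order k * pitch θ) :=
  Finset.sum_congr rfl fun t _ => by rw [harmTone, harmTone, conj_tone_mul_tone]

theorem crossCorr_eq_oscSum (S : SignalModel K) (j N : ℕ) (θ : Param K) (l k : Fin K) :
    crossCorr S j N θ l k =
      oscSum j N (phase θ k - S.phase l) (order k * pitch θ - S.freq l) :=
  Finset.sum_congr rfl fun t _ => by rw [harmTone, sigTone, conj_tone_mul_tone]

/-- The power sum `∑_{t<N} t^j`. -/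
def powSum (j N : ℕ) : ℝ := ∑ t ∈ Finset.range N, (t : ℝ) ^ j

theorem gram_self (j N : ℕ) (θ : Param K) (k : Fin K) : gram j N θ k k = (powSum j N : ℝ) := by
  rw [gram, powSum, Complex.ofReal_sum]
  refine Finset.sum_congr rfl fun t _ => ?_
  rw [harmTone, conj_tone_mul_self]
  push_cast
  ring

theorem powSum_zero (N : ℕ) : powSum 0 N = N := by simp [powSum]

theorem powSum_one (N : ℕ) : powSum 1 N = N * ((N : ℝ) - 1) / 2 := by
  induction N with
  | zero => simp [powSum]
  | succ n ih =>
    rw [powSum, Finset.sum_range_succ, ← powSum, ih]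
    push_cast
    ring

theorem powSum_two (N : ℕ) : powSum 2 N = N * ((N : ℝ) - 1) * (2 * N - 1) / 6 := by
  induction N with
  | zero => simp [powSum]
  | succ n ih =>
    rw [powSum, Finset.sum_range_succ, ← powSum, ih]
    push_cast
    ring

theorem powSum_nonneg (j N : ℕ) : 0 ≤ powSum j N := Finset.sum_nonneg fun t _ => by positivity

theorem powSum_le (j N : ℕ) : powSum j N ≤ (N : ℝ) ^ (j + 1) := by
  have h := norm_oscSum_le_pow j N 0 0
  have h2 : oscSum j N 0 0 = (powSum j N : ℝ) := by
    simp [oscSum, tone, powSum]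
  rwa [h2, Complex.norm_real, Real.norm_of_nonneg (powSum_nonneg j N)] at h

theorem resid_eq (S : SignalModel K) (j N : ℕ) (θ : Param K) (k : Fin K) :
    resid S j N θ k = ∑ l, (amp θ l : ℂ) * gram j N θ l k -
      ∑ l, (S.amp l : ℂ) * crossCorr S j N θ l k := by
  simp only [resid, gram, crossCorr, Finset.mul_sum]
  rw [Finset.sum_comm, Finset.sum_comm (s := Finset.univ) (f := fun l t => (S.amp l : ℂ) * _),
    ← Finset.sum_sub_distrib]
  refine Finset.sum_congr rfl fun t _ => ?_
  rw [waveDiff, harmWave_eq, wave_eq, map_sub, map_sum, map_sum, sub_mul, mul_sub,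
    Finset.sum_mul, Finset.sum_mul, Finset.mul_sum, Finset.mul_sum]
  congr 1 <;>
  · refine Finset.sum_congr rfl fun l _ => ?_
    rw [map_mul, Complex.conj_ofReal]
    ring

theorem crossCorr_self_re (S : SignalModel K) (j N : ℕ) (θ : Param K) (k : Fin K) :
    (crossCorr S j N θ k k).re = ∑ t ∈ Finset.range N, (t : ℝ) ^ j * Real.cos (angle S θ k t) := by
  rw [crossCorr_eq_oscSum, oscSum, Complex.re_sum]
  refine Finset.sum_congr rfl fun t _ => ?_
  rw [← Complex.ofReal_natCast, ← Complex.ofReal_pow, Complex.re_ofReal_mul, tone_re, angle]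

theorem crossCorr_self_im (S : SignalModel K) (j N : ℕ) (θ : Param K) (k : Fin K) :
    (crossCorr S j N θ k k).im = ∑ t ∈ Finset.range N, (t : ℝ) ^ j * Real.sin (angle S θ k t) := by
  rw [crossCorr_eq_oscSum, oscSum, Complex.im_sum]
  refine Finset.sum_congr rfl fun t _ => ?_
  rw [← Complex.ofReal_natCast, ← Complex.ofReal_pow, Complex.im_ofReal_mul, tone_im, angle]

end

/-- A family of signals and pseudo-true parameters, indexed by a filter along which the number of
samples tends to infinity, the amplitudes of the signals stay bounded, and the signals are almost
harmonic. -/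
structure Regime {K : ℕ} {X : Type*} (c κ : ℝ) (l : Filter X) (N : X → ℕ)
    (S : X → SignalModel K) (θ : X → Param K) : Prop where
  c_pos : 0 < c
  kappa_lt : κ < 1
  tendsto : Tendsto N l atTop
  pseudo : ∀ᶠ x in l, IsPseudoTrue (S x) (N x) (θ x)
  almost : ∀ᶠ x in l, AlmostHarmonic (S x) c κ (θ x)
  sigAmp : ∀ k, (fun x => (S x).amp k) =O[l] fun x => (N x : ℝ) ^ 0

/-! ### Sizes of correlations, amplitudes and residuals -/

namespace Regime
variable {K : ℕ} {X : Type*} {c κ : ℝ} {l : Filter X} {N : X → ℕ}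
    {S : X → SignalModel K} {θ : X → Param K}

theorem gram_isBigO (h : Regime c κ l N S θ) (j : ℕ) {k m : Fin K} (hkm : k ≠ m) :
    (fun x => gram j (N x) (θ x) k m) =O[l] fun x => (N x : ℝ) ^ j := by
  refine IsBigO.of_bound (Real.pi / ((1 - κ) * c)) ?_
  filter_upwards [h.almost] with x hx
  have h1 := hx.harm_separated h.c_pos h.kappa_lt hkm.symm
  rw [gram_eq_oscSum, Real.norm_of_nonneg (by positivity)]
  exact norm_oscSum_le (mul_pos (sub_pos.2 h.kappa_lt) h.c_pos) h1.1 h1.2 _ _ _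

theorem crossCorr_isBigO (h : Regime c κ l N S θ) (j : ℕ) {k m : Fin K} (hkm : k ≠ m) :
    (fun x => crossCorr (S x) j (N x) (θ x) k m) =O[l] fun x => (N x : ℝ) ^ j := by
  refine IsBigO.of_bound (Real.pi / ((1 - κ) * c)) ?_
  filter_upwards [h.almost] with x hx
  have h1 := hx.cross_separated h.c_pos h.kappa_lt hkm.symm
  rw [crossCorr_eq_oscSum, Real.norm_of_nonneg (by positivity)]
  exact norm_oscSum_le (mul_pos (sub_pos.2 h.kappa_lt) h.c_pos) h1.1 h1.2 _ _ _

theorem crossCorr_isBigO' (j : ℕ) (k m : Fin K) :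
    (fun x => crossCorr (S x) j (N x) (θ x) k m) =O[l] fun x => (N x : ℝ) ^ (j + 1) := by
  refine IsBigO.of_bound 1 (Eventually.of_forall fun x => ?_)
  rw [crossCorr_eq_oscSum, Real.norm_of_nonneg (by positivity), one_mul]
  exact norm_oscSum_le_pow _ _ _ _

theorem powSum_isBigO (j : ℕ) : (fun x => powSum j (N x)) =O[l] fun x => (N x : ℝ) ^ (j + 1) := by
  refine IsBigO.of_bound 1 (Eventually.of_forall fun x => ?_)
  rw [Real.norm_of_nonneg (powSum_nonneg _ _), Real.norm_of_nonneg (by positivity), one_mul]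
  exact powSum_le _ _

/-- Orthogonality of δ to e_m expresses N r_m through correlations of size at most N with the signal
and of bounded size with the other harmonics. Summed over m, the latter are absorbed for large N. -/
theorem amp_isBigO (h : Regime c κ l N S θ) (k : Fin K) :
    (fun x => amp (θ x) k) =O[l] fun x => (N x : ℝ) ^ 0 := by
  set L := Real.pi / ((1 - κ) * c) with hL
  have hLpos : 0 ≤ L := div_nonneg Real.pi_pos.le
    (mul_nonneg (sub_nonneg.2 h.kappa_lt.le) h.c_pos.le)
  have hsum : (fun x => ∑ m, (S x).amp m) =O[l] fun x => (N x : ℝ) ^ 0 :=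
    IsBigO.fun_sum fun m _ => h.sigAmp m
  refine IsBigO.trans (IsBigO.of_bound (2 * K) ?_) hsum
  -- Twice K·L makes the absorbed term at most half of the left side, which produces the constant
  -- 2K.
  have hlarge := (tendsto_natCast_atTop_atTop (R := ℝ).comp h.tendsto).eventually_ge_atTop
    (2 * (K * L) + 1)
  filter_upwards [h.pseudo, h.almost, hlarge] with x hp ha hN
  replace hN : 2 * (K * L) + 1 ≤ (N x : ℝ) := hN
  have hKL : 0 ≤ K * L := by positivity
  have hN0 : (0 : ℝ) < N x := by linarith
  have hrpos : ∀ m, 0 < amp (θ x) m := hp.1.2.2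
  have hkey : ∀ m, (N x : ℝ) * amp (θ x) m ≤
      N x * ∑ i, (S x).amp i + L * ∑ i, amp (θ x) i := by
    intro m
    have h0 := resid_zero_eq_zero hp m
    rw [resid_eq, sub_eq_zero, ← Finset.add_sum_erase _ _ (Finset.mem_univ m), gram_self,
      powSum_zero] at h0
    have h1 : ((amp (θ x) m * N x : ℝ) : ℂ) =
        ∑ i, ((S x).amp i : ℂ) * crossCorr (S x) 0 (N x) (θ x) i m -
          ∑ i ∈ Finset.univ.erase m, (amp (θ x) i : ℂ) * gram 0 (N x) (θ x) i m := by
      rw [← h0]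
      push_cast
      ring
    have h2 := congrArg norm h1
    rw [Complex.norm_real, Real.norm_of_nonneg (mul_nonneg (hrpos m).le hN0.le), mul_comm] at h2
    rw [h2]
    refine (norm_sub_le _ _).trans (add_le_add ?_ ?_)
    · rw [Finset.mul_sum]
      refine (norm_sum_le _ _).trans (Finset.sum_le_sum fun i _ => ?_)
      rw [norm_mul, Complex.norm_real, Real.norm_of_nonneg ((S x).amp_pos i).le, mul_comm,
        crossCorr_eq_oscSum]
      refine mul_le_mul_of_nonneg_right ?_ ((S x).amp_pos i).le
      simpa using norm_oscSum_le_pow 0 (N x) _ _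
    · rw [Finset.mul_sum]
      refine (norm_sum_le _ _).trans ((Finset.sum_le_sum fun i hi => ?_).trans
        (Finset.sum_le_sum_of_subset_of_nonneg (Finset.erase_subset _ _)
          fun i _ _ => mul_nonneg hLpos (hrpos i).le))
      rw [norm_mul, Complex.norm_real, Real.norm_of_nonneg (hrpos i).le, mul_comm, gram_eq_oscSum]
      refine mul_le_mul_of_nonneg_right ?_ (hrpos i).le
      have h3 := ha.harm_separated h.c_pos h.kappa_lt (Finset.ne_of_mem_erase hi).symm
      simpa using norm_oscSum_le (mul_pos (sub_pos.2 h.kappa_lt) h.c_pos) h3.1 h3.2 0 (N x) _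
  have hR : (N x : ℝ) * ∑ i, amp (θ x) i ≤
      K * (N x * ∑ i, (S x).amp i + L * ∑ i, amp (θ x) i) := by
    rw [Finset.mul_sum]
    refine (Finset.sum_le_sum fun i _ => hkey i).trans ?_
    simp [mul_add]
  have hRpos : 0 ≤ ∑ i, amp (θ x) i := Finset.sum_nonneg fun i _ => (hrpos i).le
  have hApos : 0 ≤ ∑ i, (S x).amp i := Finset.sum_nonneg fun i _ => ((S x).amp_pos i).le
  have hfin : ∑ i, amp (θ x) i ≤ 2 * K * ∑ i, (S x).amp i := by
    refine le_of_mul_le_mul_left ?_ hN0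
    nlinarith [mul_le_mul_of_nonneg_right hN hRpos]
  rw [Real.norm_of_nonneg (hrpos k).le, Real.norm_of_nonneg hApos]
  exact (Finset.single_le_sum (fun i _ => (hrpos i).le) (Finset.mem_univ k)).trans hfin

theorem ofReal_isBigO {f : X → ℝ} {g : X → ℝ} (hf : f =O[l] g) :
    (fun x => (f x : ℂ)) =O[l] g :=
  (IsBigO.of_norm_le fun x => (Complex.norm_real (f x)).le).trans hf.norm_left

/-- Only the model tone and the signal tone of the same order can be coherent with e_k. All other
orders are separated in frequency and contribute O(N^j). -/
theorem resid_isBigO (h : Regime c κ l N S θ) (j : ℕ) (k : Fin K) :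
    (fun x => resid (S x) j (N x) (θ x) k - ((amp (θ x) k * powSum j (N x) : ℝ) -
      ((S x).amp k : ℂ) * crossCorr (S x) j (N x) (θ x) k k)) =O[l] fun x => (N x : ℝ) ^ j := by
  have h1 : (fun x => ∑ m ∈ Finset.univ.erase k,
      ((amp (θ x) m : ℂ) * gram j (N x) (θ x) m k -
        ((S x).amp m : ℂ) * crossCorr (S x) j (N x) (θ x) m k)) =O[l]
      fun x => (N x : ℝ) ^ j := by
    refine IsBigO.fun_sum fun m hm => ?_
    have hm' := Finset.ne_of_mem_erase hm
    have h2 := (ofReal_isBigO (h.amp_isBigO m)).mul (h.gram_isBigO j hm')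
    have h3 := (ofReal_isBigO (h.sigAmp m)).mul (h.crossCorr_isBigO j hm')
    simpa only [pow_zero, one_mul] using h2.sub h3
  refine h1.congr_left fun x => ?_
  rw [resid_eq, ← Finset.sum_sub_distrib, ← Finset.add_sum_erase _ _ (Finset.mem_univ k),
    gram_self]
  push_cast
  ring

end Regime

/-! ### Leading terms and their exact relation to C, D, E and Z -/

section
variable {K : ℕ}

/-- The leading part of the border of the Gram matrix. -/
def gramMain (N : ℕ) (θ : Param K) : Fin K ⊕ Fin K → ℝ :=
  Sum.elim (fun k => order k * (amp θ k * powSum 1 N)) fun _ => 0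

/-- The leading part of the border of the Hessian of the criterion. -/
def hessMain (S : SignalModel K) (N : ℕ) (θ : Param K) : Fin K ⊕ Fin K → ℝ :=
  Sum.elim (fun k => order k * (S.amp k * (crossCorr S 1 N θ k k).re))
    fun k => order k * (S.amp k * (crossCorr S 1 N θ k k).im)

/-- The leading part of the corner of the Gram matrix. -/
def gramCornerMain (N : ℕ) (θ : Param K) : ℝ :=
  ∑ k, order k ^ 2 * amp θ k ^ 2 * powSum 2 N

/-- The leading part of the corner of the curvature matrix. -/
def curvCornerMain (S : SignalModel K) (N : ℕ) (θ : Param K) : ℝ :=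
  -∑ k, order k ^ 2 * amp θ k * (amp θ k * powSum 2 N - S.amp k * (crossCorr S 2 N θ k k).re)

theorem termC_eq (N : ℕ) (θ : Param K) :
    termC N θ = ∑ k : Fin K, (N : ℝ) * ((N : ℝ) ^ 2 - 1) / 6 * (order k ^ 2 * amp θ k ^ 2) := by
  rw [termC, ← Finset.mul_sum]
  ring

theorem termE_eq (S : SignalModel K) (N : ℕ) (θ : Param K) :
    termE S N θ = ∑ k : Fin K, 2 / (N : ℝ) * order k ^ 2 *
      ((S.amp k * (crossCorr S 1 N θ k k).im) ^ 2 +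
        (S.amp k * (crossCorr S 1 N θ k k).re - amp θ k * powSum 1 N) ^ 2) := by
  simp only [termE, crossCorr_self_re, crossCorr_self_im, pow_one, powSum_one]
  rw [← mul_add, ← Finset.sum_add_distrib, Finset.mul_sum]
  exact Finset.sum_congr rfl fun k _ => by ring

theorem termZ_eq (S : SignalModel K) (N : ℕ) (θ : Param K) :
    termZ S N θ = ∑ k : Fin K, 2 * order k ^ 2 * amp θ k *
      (S.amp k * (crossCorr S 2 N θ k k).re - amp θ k * powSum 2 N) := by
  have h : ∀ k, ∑ t ∈ Finset.range N,
      order k ^ 2 * amp θ k * S.amp k * (t : ℝ) ^ 2 * Real.cos (angle S θ k t) =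
      order k ^ 2 * amp θ k * S.amp k * (crossCorr S 2 N θ k k).re := fun k => by
    rw [crossCorr_self_re, Finset.mul_sum]
    exact Finset.sum_congr rfl fun t _ => by ring
  simp only [termZ, h, powSum_two]
  rw [neg_mul, ← mul_neg, ← mul_add, ← Finset.sum_neg_distrib, ← Finset.sum_add_distrib,
    Finset.mul_sum]
  exact Finset.sum_congr rfl fun k _ => by ring

theorem termD_eq (S : SignalModel K) (N : ℕ) (θ : Param K) :
    termD S N θ = ∑ k : Fin K, 2 * ((N : ℝ) - 1) * (order k ^ 2 * amp θ k *
      (amp θ k * powSum 1 N - S.amp k * (crossCorr S 1 N θ k k).re)) := by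
  have h : ∀ k, ∑ t ∈ Finset.range N,
      order k ^ 2 * amp θ k * S.amp k * (t : ℝ) * Real.cos (angle S θ k t) =
      order k ^ 2 * amp θ k * S.amp k * (crossCorr S 1 N θ k k).re := fun k => by
    rw [crossCorr_self_re, Finset.mul_sum]
    exact Finset.sum_congr rfl fun t _ => by ring
  simp only [termD, h, powSum_one]
  rw [Finset.mul_sum, ← Finset.sum_sub_distrib, Finset.mul_sum]
  exact Finset.sum_congr rfl fun k _ => by ring

open Matrix in
-- An exact identity for each order. With P_j = ∑ t^j, the coefficient in C is N(N²-1)/6 = 2(P₂ -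
-- P₁²/N), and the square in E restores the missing 2P₁²/N.
theorem termC_add_termE (S : SignalModel K) {N : ℕ} (hN : 0 < N) (θ : Param K) :
    termC N θ + termE S N θ = 2 * (gramCornerMain N θ -
      2 * ((gramMain N θ ⬝ᵥ hessMain S N θ) / N) + (hessMain S N θ ⬝ᵥ hessMain S N θ) / N) := by
  have hN' : (N : ℝ) ≠ 0 := by positivity
  simp only [termC_eq, termE_eq, gramCornerMain, gramMain, hessMain, dotProduct,
    Fintype.sum_sum_type, Sum.elim_inl, Sum.elim_inr, zero_mul, Finset.sum_const_zero, add_zero,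
    powSum_one, powSum_two]
  simp only [Finset.mul_sum, Finset.sum_div, ← Finset.sum_add_distrib,
    ← Finset.sum_sub_distrib]
  refine Finset.sum_congr rfl fun k _ => ?_
  field_simp
  ring

open Matrix in
-- Since 2(N-1) = 4P₁/N, the term D cancels the mixed terms and the P₁² terms of C - E, leaving
-- twice the Gram corner minus the squared border. Z is twice the leading curvature corner.
theorem denom_eq (S : SignalModel K) {N : ℕ} (hN : 0 < N) (θ : Param K) :
    denom S N θ = 2 * (gramCornerMain N θ + curvCornerMain S N θ -
      (hessMain S N θ ⬝ᵥ hessMain S N θ) / N) := by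
  have hN' : (N : ℝ) ≠ 0 := by positivity
  simp only [denom, termC_eq, termE_eq, termZ_eq, termD_eq, gramCornerMain, curvCornerMain,
    hessMain, dotProduct, Fintype.sum_sum_type, Sum.elim_inl, Sum.elim_inr, powSum_one, powSum_two]
  simp only [Finset.mul_sum, Finset.sum_div, ← Finset.sum_add_distrib,
    ← Finset.sum_sub_distrib, ← Finset.sum_neg_distrib]
  refine Finset.sum_congr rfl fun k _ => ?_
  field_simp
  ring

end

/-! ### The bound in a regime of growing sample size -/

namespace Regime
open Matrix
variable {K : ℕ} {X : Type*} {c κ : ℝ} {l : Filter X} {N : X → ℕ}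
    {S : X → SignalModel K} {θ : X → Param K}

theorem nuisBlock_isBigO (h : Regime c κ l N S θ) (i j : Fin K ⊕ Fin K) :
    (fun x => nuisBlock (N x) (θ x) i j - if i = j then (N x : ℝ) else 0) =O[l]
      fun x => (N x : ℝ) ^ 0 := by
  rcases i with k | k <;> rcases j with m | m <;> by_cases hkm : k = m
  · subst hkm
    refine (isBigO_zero _ l).congr_left fun x => ?_
    simp [nuisBlock, gram_self, powSum_zero]
  · simpa [nuisBlock, hkm] using isBigO_re (h.gram_isBigO 0 hkm)
  · subst hkm
    refine (isBigO_zero _ l).congr_left fun x => ?_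
    simp [nuisBlock, gram_self, powSum_zero]
  · simpa [nuisBlock, hkm] using isBigO_im (h.gram_isBigO 0 hkm)
  · subst hkm
    refine (isBigO_zero _ l).congr_left fun x => ?_
    simp [nuisBlock, gram_self, powSum_zero]
  · simpa [nuisBlock, hkm] using isBigO_im (h.gram_isBigO 0 hkm)
  · subst hkm
    refine (isBigO_zero _ l).congr_left fun x => ?_
    simp [nuisBlock, gram_self, powSum_zero]
  · simpa [nuisBlock, hkm] using isBigO_re (h.gram_isBigO 0 hkm)

theorem gramMain_isBigO (h : Regime c κ l N S θ) (i : Fin K ⊕ Fin K) :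
    (fun x => gramMain (N x) (θ x) i) =O[l] fun x => (N x : ℝ) ^ 2 := by
  rcases i with k | k
  · have := isBigO_pow_mul (h.amp_isBigO k) (powSum_isBigO (l := l) (N := N) 1)
    exact this.const_mul_left _
  · exact isBigO_zero _ l

theorem hessMain_isBigO (h : Regime c κ l N S θ) (i : Fin K ⊕ Fin K) :
    (fun x => hessMain (S x) (N x) (θ x) i) =O[l] fun x => (N x : ℝ) ^ 2 := by
  rcases i with k | k
  · have := isBigO_pow_mul (h.sigAmp k)
      (isBigO_re (crossCorr_isBigO' (l := l) (N := N) (S := S) (θ := θ) 1 k k))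
    exact this.const_mul_left _
  · have := isBigO_pow_mul (h.sigAmp k)
      (isBigO_im (crossCorr_isBigO' (l := l) (N := N) (S := S) (θ := θ) 1 k k))
    exact this.const_mul_left _

theorem gramBorder_sub_isBigO (h : Regime c κ l N S θ) (i : Fin K ⊕ Fin K) :
    (fun x => gramBorder (N x) (θ x) i - gramMain (N x) (θ x) i) =O[l]
      fun x => (N x : ℝ) ^ 1 := by
  rcases i with k | k
  · have h1 : (fun x => ∑ m ∈ Finset.univ.erase k,
        order m * (amp (θ x) m * (gram 1 (N x) (θ x) m k).re)) =O[l]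
        fun x => (N x : ℝ) ^ (0 + 1) := IsBigO.fun_sum fun m hm =>
      (isBigO_pow_mul (h.amp_isBigO m)
        (isBigO_re (h.gram_isBigO 1 (Finset.ne_of_mem_erase hm)))).const_mul_left _
    refine h1.congr_left fun x => ?_
    simp only [gramBorder, gramMain, Sum.elim_inl]
    rw [← Finset.add_sum_erase _ _ (Finset.mem_univ k), gram_self, Complex.ofReal_re,
      mul_assoc, add_sub_cancel_left]
    exact Finset.sum_congr rfl fun m _ => by ring
  · have h1 : (fun x => ∑ m ∈ Finset.univ.erase k,
        order m * (amp (θ x) m * (gram 1 (N x) (θ x) m k).im)) =O[l]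
        fun x => (N x : ℝ) ^ (0 + 1) := IsBigO.fun_sum fun m hm =>
      (isBigO_pow_mul (h.amp_isBigO m)
        (isBigO_im (h.gram_isBigO 1 (Finset.ne_of_mem_erase hm)))).const_mul_left _
    refine h1.congr_left fun x => ?_
    simp only [gramBorder, gramMain, Sum.elim_inr]
    rw [← Finset.add_sum_erase _ _ (Finset.mem_univ k), gram_self, Complex.ofReal_im,
      mul_zero, zero_add, sub_zero]
    exact Finset.sum_congr rfl fun m _ => by ring

/-- The model contributions k r_k P₁ of the Gram and curvature borders cancel, so only the signal
correlation survives at order N². -/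
theorem border_sub_isBigO (h : Regime c κ l N S θ) (i : Fin K ⊕ Fin K) :
    (fun x => (gramBorder (N x) (θ x) + curvBorder (S x) (N x) (θ x)) i -
      hessMain (S x) (N x) (θ x) i) =O[l] fun x => (N x : ℝ) ^ 1 := by
  rcases i with k | k
  · have h1 := (h.gramBorder_sub_isBigO (Sum.inl k)).sub
      ((isBigO_re (h.resid_isBigO 1 k)).const_mul_left (order k))
    refine h1.congr_left fun x => ?_
    simp only [gramMain, curvBorder, hessMain, Sum.elim_inl, Pi.add_apply, Complex.sub_re,
      Complex.ofReal_re, Complex.re_ofReal_mul]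
    ring
  · have h1 := (h.gramBorder_sub_isBigO (Sum.inr k)).sub
      ((isBigO_im (h.resid_isBigO 1 k)).const_mul_left (order k))
    refine h1.congr_left fun x => ?_
    simp only [gramMain, curvBorder, hessMain, Sum.elim_inr, Pi.add_apply, Complex.sub_im,
      Complex.ofReal_im, Complex.im_ofReal_mul]
    ring

theorem gramCorner_sub_isBigO (h : Regime c κ l N S θ) :
    (fun x => gramCorner (N x) (θ x) - gramCornerMain (N x) (θ x)) =O[l]
      fun x => (N x : ℝ) ^ 2 := by
  have h1 : (fun x => ∑ k, ∑ m ∈ Finset.univ.erase k, order k * order m *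
      (amp (θ x) k * (amp (θ x) m * (gram 2 (N x) (θ x) k m).re))) =O[l]
      fun x => (N x : ℝ) ^ (0 + (0 + 2)) :=
    IsBigO.fun_sum fun k _ => IsBigO.fun_sum fun m hm =>
      (isBigO_pow_mul (h.amp_isBigO k) (isBigO_pow_mul (h.amp_isBigO m)
        (isBigO_re (h.gram_isBigO 2 (Finset.ne_of_mem_erase hm).symm)))).const_mul_left _
  refine h1.congr_left fun x => ?_
  rw [gramCorner, gramCornerMain, ← Finset.sum_sub_distrib]
  refine Finset.sum_congr rfl fun k _ => ?_
  rw [← Finset.add_sum_erase _ _ (Finset.mem_univ k), gram_self, Complex.ofReal_re,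
    show order k * amp (θ x) k * (order k * amp (θ x) k) * powSum 2 (N x) =
      order k ^ 2 * amp (θ x) k ^ 2 * powSum 2 (N x) by ring, add_sub_cancel_left]
  exact Finset.sum_congr rfl fun m _ => by ring

theorem curvCorner_sub_isBigO (h : Regime c κ l N S θ) :
    (fun x => curvCorner (S x) (N x) (θ x) - curvCornerMain (S x) (N x) (θ x)) =O[l]
      fun x => (N x : ℝ) ^ 2 := by
  have h1 : (fun x => ∑ k, -order k ^ 2 * (amp (θ x) k * (resid (S x) 2 (N x) (θ x) k -
      ((amp (θ x) k * powSum 2 (N x) : ℝ) -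
        ((S x).amp k : ℂ) * crossCorr (S x) 2 (N x) (θ x) k k)).re)) =O[l]
      fun x => (N x : ℝ) ^ (0 + 2) := IsBigO.fun_sum fun k _ =>
    (isBigO_pow_mul (h.amp_isBigO k) (isBigO_re (h.resid_isBigO 2 k))).const_mul_left _
  refine h1.congr_left fun x => ?_
  rw [curvCorner, curvCornerMain, ← Finset.sum_neg_distrib, ← Finset.sum_neg_distrib,
    ← Finset.sum_sub_distrib]
  refine Finset.sum_congr rfl fun k _ => ?_
  simp only [Complex.sub_re, Complex.ofReal_re, Complex.re_ofReal_mul]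
  ring

theorem termC_add_termE_isBigO (h : Regime c κ l N S θ) :
    (fun x => termC (N x) (θ x) + termE (S x) (N x) (θ x)) =O[l] fun x => (N x : ℝ) ^ 3 := by
  have h1 : (fun x => gramCornerMain (N x) (θ x)) =O[l] fun x => (N x : ℝ) ^ (0 + (0 + 3)) := by
    refine (IsBigO.fun_sum (s := Finset.univ) fun k _ => (isBigO_pow_mul (h.amp_isBigO k)
      (isBigO_pow_mul (h.amp_isBigO k)
        (powSum_isBigO (l := l) (N := N) 2))).const_mul_left (order k ^ 2)).congr_left fun x => ?_
    rw [gramCornerMain]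
    exact Finset.sum_congr rfl fun k _ => by ring
  have hdot : ∀ {u v : X → Fin K ⊕ Fin K → ℝ},
      (∀ i, (fun x => u x i) =O[l] fun x => (N x : ℝ) ^ 2) →
      (∀ i, (fun x => v x i) =O[l] fun x => (N x : ℝ) ^ 2) →
      (fun x => (u x ⬝ᵥ v x) / N x) =O[l] fun x => (N x : ℝ) ^ 3 := fun hu hv =>
    isBigO_pow_div (a := 3) h.tendsto
      (IsBigO.fun_sum fun i _ => isBigO_pow_mul (a := 2) (b := 2) (hu i) (hv i))
  have h2 := hdot h.gramMain_isBigO h.hessMain_isBigO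
  have h3 := hdot h.hessMain_isBigO h.hessMain_isBigO
  refine (((h1.sub (h2.const_mul_left 2)).add h3).const_mul_left 2).congr' ?_ EventuallyEq.rfl
  filter_upwards [h.tendsto.eventually_ge_atTop 1] with x hx
  rw [termC_add_termE _ hx]

/-- A quotient `p / q ^ 2` with `p = O(N³)` and `q ≥ ρ N³` changes by `O(N⁻⁴)` when `p` and `q`
change by `O(N²)`. -/
theorem isBigO_div_sq_sub (hN : Tendsto N l atTop) {p p' q q' : X → ℝ} {ρ : ℝ} (hρ : 0 < ρ)
    (hp : p =O[l] fun x => (N x : ℝ) ^ 3) (hq : ∀ᶠ x in l, ρ * (N x : ℝ) ^ 3 ≤ q x)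
    (hpp : (fun x => p' x - p x) =O[l] fun x => (N x : ℝ) ^ 2)
    (hqq : (fun x => q' x - q x) =O[l] fun x => (N x : ℝ) ^ 2) :
    (∀ᶠ x in l, q' x ≠ 0) ∧
      (fun x => p' x / q' x ^ 2 - p x / q x ^ 2) =O[l] fun x => ((N x : ℝ) ^ 4)⁻¹ := by
  have hpos : ∀ᶠ x in l, (0 : ℝ) < N x := by
    filter_upwards [hN.eventually_ge_atTop 1] with x hx
    exact_mod_cast hx
  have hq' : ∀ᶠ x in l, ρ / 2 * (N x : ℝ) ^ 3 ≤ q' x := by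
    obtain ⟨d, hd⟩ := hqq.bound
    have hlarge := (tendsto_natCast_atTop_atTop (R := ℝ).comp hN).eventually_ge_atTop (2 * d / ρ)
    filter_upwards [hd, hq, hpos, hlarge] with x h1 h2 h3 h4
    replace h4 : 2 * d / ρ ≤ (N x : ℝ) := h4
    rw [div_le_iff₀ hρ] at h4
    rw [Real.norm_of_nonneg (by positivity : (0 : ℝ) ≤ (N x : ℝ) ^ 2), Real.norm_eq_abs] at h1
    have h5 := (abs_le.1 h1).1
    have h6 : 2 * d * (N x : ℝ) ^ 2 ≤ N x * ρ * (N x : ℝ) ^ 2 :=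
      mul_le_mul_of_nonneg_right h4 (by positivity)
    nlinarith
  have hinv : ∀ {r : X → ℝ} {τ : ℝ}, 0 < τ → (∀ᶠ x in l, τ * (N x : ℝ) ^ 3 ≤ r x) →
      (fun x => (r x)⁻¹) =O[l] fun x => ((N x : ℝ) ^ 3)⁻¹ := by
    intro r τ hτ hr
    refine IsBigO.of_bound τ⁻¹ ?_
    filter_upwards [hr, hpos] with x h1 h2
    have h3 : 0 < τ * (N x : ℝ) ^ 3 := by positivity
    rw [Real.norm_of_nonneg (inv_nonneg.2 (h3.le.trans h1)), Real.norm_of_nonneg (by positivity),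
      ← mul_inv]
    exact inv_anti₀ h3 h1
  have hq0 : ∀ᶠ x in l, q' x ≠ 0 := by
    filter_upwards [hq', hpos] with x h1 h2
    have : 0 < ρ / 2 * (N x : ℝ) ^ 3 := by positivity
    linarith
  refine ⟨hq0, ?_⟩
  have i1 := hinv hρ hq
  have i2 := hinv (half_pos hρ) hq'
  -- The three terms of p'/q'² - p/q² = (p'-p)/q'² - p(q'-q)/(q'²q) - p(q'-q)/(q'q²).
  have e1 := hpp.mul (i2.mul i2)
  have e2 := (hp.mul hqq).mul ((i2.mul i2).mul i1)
  have e3 := (hp.mul hqq).mul ((i2.mul i1).mul i1)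
  have s1 : ∀ᶠ x in l, (N x : ℝ) ^ 2 * (((N x : ℝ) ^ 3)⁻¹ * ((N x : ℝ) ^ 3)⁻¹) =
      ((N x : ℝ) ^ 4)⁻¹ := by
    filter_upwards [hpos] with x hx
    field_simp
  have s2 : ∀ᶠ x in l, (N x : ℝ) ^ 3 * (N x : ℝ) ^ 2 *
      ((((N x : ℝ) ^ 3)⁻¹ * ((N x : ℝ) ^ 3)⁻¹) * ((N x : ℝ) ^ 3)⁻¹) = ((N x : ℝ) ^ 4)⁻¹ := by
    filter_upwards [hpos] with x hx
    field_simp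
  replace e1 := e1.congr' EventuallyEq.rfl s1
  replace e2 := e2.congr' EventuallyEq.rfl s2
  replace e3 := e3.congr' EventuallyEq.rfl s2
  refine ((e1.sub e2).sub e3).congr' ?_ EventuallyEq.rfl
  filter_upwards [hq0, hq, hpos] with x h1 h2 h3
  have h4 : q x ≠ 0 := by
    have : 0 < ρ * (N x : ℝ) ^ 3 := by positivity
    linarith
  field_simp
  ring

/-- The Schur formula is applied with w = B⁻¹v. Its numerator and denominator, both doubled, differ
from C+E and C-E+Z+D by O(N²). The factor 2 against 4 in the quotient turns s/2 into s. -/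
theorem mcrlb_isBigO (h : Regime c κ l N S θ) {s ρ : ℝ} (hs : 0 < s) (hρ : 0 < ρ)
    (hden : ∀ᶠ x in l, ρ * (N x : ℝ) ^ 3 ≤ denom (S x) (N x) (θ x)) :
    (∀ᶠ x in l, IsUnit (matA (S x) s (N x) (θ x)).det) ∧
      (fun x => mcrlbPitch (S x) s (N x) (θ x) -
        s * ((termC (N x) (θ x) + termE (S x) (N x) (θ x)) / denom (S x) (N x) (θ x) ^ 2))
        =O[l] fun x => ((N x : ℝ) ^ 4)⁻¹ := by
  set u : X → Fin K ⊕ Fin K → ℝ := fun x => gramBorder (N x) (θ x) with hu_def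
  set v : X → Fin K ⊕ Fin K → ℝ :=
    fun x => gramBorder (N x) (θ x) + curvBorder (S x) (N x) (θ x) with hv_def
  set w : X → Fin K ⊕ Fin K → ℝ := fun x => (nuisBlock (N x) (θ x))⁻¹ *ᵥ v x with hw_def
  have hone : (1 : ℕ) ≤ 2 := by norm_num
  have hu : ∀ i, (fun x => u x i) =O[l] fun x => (N x : ℝ) ^ 2 := fun i =>
    ((isBigO_pow_mono h.tendsto hone (h.gramBorder_sub_isBigO i)).add
      (h.gramMain_isBigO i)).congr_left fun x => by simp [hu_def]
  have hv : ∀ i, (fun x => v x i) =O[l] fun x => (N x : ℝ) ^ 2 := fun i =>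
    ((isBigO_pow_mono h.tendsto hone (h.border_sub_isBigO i)).add
      (h.hessMain_isBigO i)).congr_left fun x => by simp [hv_def]
  obtain ⟨hunit, hw⟩ := nearScalar_inv h.tendsto h.nuisBlock_isBigO hv
  have huw := isBigO_dotProduct_sub h.tendsto hu h.hessMain_isBigO h.gramBorder_sub_isBigO
    h.border_sub_isBigO hw
  have hvw := isBigO_dotProduct_sub h.tendsto hv h.hessMain_isBigO h.border_sub_isBigO
    h.border_sub_isBigO hw
  have hposN := h.tendsto.eventually_ge_atTop 1
  have hp : (fun x => 2 * (gramCorner (N x) (θ x) - 2 * (u x ⬝ᵥ w x) + v x ⬝ᵥ w x) -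
      (termC (N x) (θ x) + termE (S x) (N x) (θ x))) =O[l] fun x => (N x : ℝ) ^ 2 := by
    refine (((h.gramCorner_sub_isBigO.sub (huw.const_mul_left 2)).add hvw).const_mul_left
      2).congr' ?_ EventuallyEq.rfl
    filter_upwards [hposN] with x hx
    rw [termC_add_termE _ hx]
    ring
  have hq : (fun x => 2 * (gramCorner (N x) (θ x) + curvCorner (S x) (N x) (θ x) - v x ⬝ᵥ w x) -
      denom (S x) (N x) (θ x)) =O[l] fun x => (N x : ℝ) ^ 2 := by
    refine (((h.gramCorner_sub_isBigO.add h.curvCorner_sub_isBigO).sub hvw).const_mul_left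
      2).congr' ?_ EventuallyEq.rfl
    filter_upwards [hposN] with x hx
    rw [denom_eq _ hx]
    ring
  obtain ⟨hne, hquot⟩ := isBigO_div_sq_sub h.tendsto hρ h.termC_add_termE_isBigO hden hp hq
  have hval : ∀ᶠ x in l, IsUnit (matA (S x) s (N x) (θ x)).det ∧
      mcrlbPitch (S x) s (N x) (θ x) = s / 2 * ((gramCorner (N x) (θ x) - 2 * (u x ⬝ᵥ w x) +
        v x ⬝ᵥ w x) / (gramCorner (N x) (θ x) + curvCorner (S x) (N x) (θ x) -
          v x ⬝ᵥ w x) ^ 2) := by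
    filter_upwards [h.pseudo, hunit, hne] with x h1 h2 h3
    refine mcrlbPitch_eq hs h1 h2 ?_ (right_ne_zero_of_mul h3)
    rw [hw_def]
    simp only
    rw [Matrix.mulVec_mulVec, Matrix.mul_nonsing_inv _ h2, Matrix.one_mulVec]
  refine ⟨hval.mono fun x hx => hx.1, (hquot.const_mul_left s).congr' ?_ EventuallyEq.rfl⟩
  filter_upwards [hval, hne] with x h1 h2
  have h3 := right_ne_zero_of_mul h2
  rw [h1.2, mul_sub]
  congr 1
  field_simp

end Regime

/-! ### Comparison with competing parameters -/

section
variable {K : ℕ}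

/-- The global minimum is also a lower bound for the criterion at vanishing amplitudes. -/
theorem sum_norm_sq_le_of_nonneg {S : SignalModel K} {N : ℕ} {θ : Param K}
    (h : IsPseudoTrue S N θ) {η : Param K} (hη : ∀ k, 0 ≤ amp η k) :
    ∑ t ∈ Finset.range N, ‖S.wave t - harmWave t θ‖ ^ 2 ≤
      ∑ t ∈ Finset.range N, ‖S.wave t - harmWave t η‖ ^ 2 := by
  let η' : ℝ → Param K := fun ε => η + Sum.elim (fun _ => 0) (Sum.elim (fun _ => 0) fun _ => ε)
  have htone : ∀ ε k t, harmTone (η' ε) k t = harmTone η k t := fun ε k t => by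
    simp [η', harmTone, phase, pitch]
  have hamp : ∀ ε k, amp (η' ε) k = amp η k + ε := fun ε k => by simp [η', amp]
  have hcont : Continuous fun ε => ∑ t ∈ Finset.range N, ‖S.wave t - harmWave t (η' ε)‖ ^ 2 := by
    simp only [harmWave_eq, htone, hamp]
    fun_prop
  have h0 : η' 0 = η := by
    ext i
    rcases i with i | i | i <;> simp [η']
  have hlim := (hcont.tendsto 0).mono_left (nhdsWithin_le_nhds (s := Set.Ioi 0))
  simp only [h0] at hlim
  refine ge_of_tendsto hlim ?_
  filter_upwards [self_mem_nhdsWithin] with ε hε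
  refine sum_norm_sq_le h fun k => ?_
  rw [hamp]
  have : 0 < ε := hε
  have := hη k
  linarith

/-- The correlation `∑_t conj(f_t) g_t` of two sequences. -/
def corr (N : ℕ) (f g : ℕ → ℂ) : ℂ := ∑ t ∈ Finset.range N, conj (f t) * g t

theorem corr_sum_sum {ι ι' : Type*} (s : Finset ι) (s' : Finset ι') (N : ℕ) (f : ι → ℕ → ℂ)
    (g : ι' → ℕ → ℂ) :
    corr N (fun t => ∑ i ∈ s, f i t) (fun t => ∑ j ∈ s', g j t) =
      ∑ i ∈ s, ∑ j ∈ s', corr N (f i) (g j) := by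
  simp only [corr, map_sum, Finset.sum_mul, Finset.mul_sum]
  rw [Finset.sum_comm]
  exact (Finset.sum_congr rfl fun j _ => Finset.sum_comm).trans Finset.sum_comm

theorem corr_conj (N : ℕ) (f g : ℕ → ℂ) : conj (corr N f g) = corr N g f := by
  simp only [corr, map_sum, map_mul, Complex.conj_conj]
  exact Finset.sum_congr rfl fun t _ => mul_comm _ _

theorem corr_self (N : ℕ) (f : ℕ → ℂ) :
    corr N f f = ((∑ t ∈ Finset.range N, ‖f t‖ ^ 2 : ℝ) : ℂ) := by
  rw [corr, Complex.ofReal_sum]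
  refine Finset.sum_congr rfl fun t _ => ?_
  rw [Complex.conj_mul', Complex.ofReal_pow]

theorem sum_norm_add_sq (N : ℕ) (f g : ℕ → ℂ) :
    ∑ t ∈ Finset.range N, ‖f t + g t‖ ^ 2 = ∑ t ∈ Finset.range N, ‖f t‖ ^ 2 +
      ∑ t ∈ Finset.range N, ‖g t‖ ^ 2 + 2 * (corr N f g).re := by
  rw [corr, Complex.re_sum, Finset.mul_sum, ← Finset.sum_add_distrib, ← Finset.sum_add_distrib]
  refine Finset.sum_congr rfl fun t _ => ?_
  simp only [Complex.sq_norm, Complex.normSq_apply, Complex.add_re, Complex.add_im, Complex.mul_re,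
    Complex.conj_re, Complex.conj_im]
  ring

theorem corr_harmTone (N : ℕ) (θ : Param K) (k m : Fin K) :
    corr N (harmTone θ k) (harmTone θ m) = gram 0 N θ k m := by
  simp [corr, gram]

theorem corr_sigTone_harmTone (S : SignalModel K) (N : ℕ) (θ : Param K) (k m : Fin K) :
    corr N (sigTone S k) (harmTone θ m) = crossCorr S 0 N θ k m := by
  simp [corr, crossCorr]

theorem corr_tone (N : ℕ) (β α β' α' : ℝ) :
    corr N (tone β α) (tone β' α') = oscSum 0 N (β' - β) (α' - α) := by
  simp [corr, oscSum, conj_tone_mul_tone]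

/-- Two tones with distinct fixed frequencies have bounded correlation. -/
theorem exists_norm_corr_tone_le {α α' : ℝ} (hα : α ∈ Set.Ico (-Real.pi) Real.pi)
    (hα' : α' ∈ Set.Ico (-Real.pi) Real.pi) (hne : α ≠ α') :
    ∃ b, ∀ N β β', ‖corr N (tone β α) (tone β' α')‖ ≤ b := by
  have h1 : 0 < |α' - α| := abs_pos.2 (sub_ne_zero.2 hne.symm)
  have h2 : |α' - α| < 2 * Real.pi := by
    rw [abs_lt]
    constructor <;> linarith [hα.1, hα.2, hα'.1, hα'.2]
  have hε : 0 < min |α' - α| (2 * Real.pi - |α' - α|) := lt_min h1 (by linarith)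
  refine ⟨Real.pi / min |α' - α| (2 * Real.pi - |α' - α|), fun N β β' => ?_⟩
  rw [corr_tone]
  have := norm_oscSum_le hε (min_le_left _ _)
    (by linarith [min_le_right |α' - α| (2 * Real.pi - |α' - α|)]) 0 N (β' - β)
  simpa using this

end

/-! ### Existence of a harmonic close to its component -/

namespace Regime
open Matrix
variable {K : ℕ} {X : Type*} {c κ : ℝ} {l : Filter X} {N : X → ℕ}

theorem mono {S : X → SignalModel K} {θ : X → Param K} (h : Regime c κ l N S θ) {l' : Filter X}
    (hl : l' ≤ l) : Regime c κ l' N S θ where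
  c_pos := h.c_pos
  kappa_lt := h.kappa_lt
  tendsto := h.tendsto.mono_left hl
  pseudo := h.pseudo.filter_mono hl
  almost := h.almost.filter_mono hl
  sigAmp k := (h.sigAmp k).mono hl

variable {S : SignalModel K} {θ : X → Param K}

/-- Components with equal frequencies may cancel. If the signal vanishes, orthogonality puts the
positive amplitudes into the kernel of the nuisance block, which is invertible for large N; hence
there is no pseudo-true parameter. -/
theorem eventually_false_of_wave_eq_zero (hK : 0 < K) (h : Regime c κ l N (fun _ => S) θ)
    (h0 : ∀ t, S.wave t = 0) : ∀ᶠ _ in l, False := by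
  have hunit := (nearScalar_inv (v := fun _ _ => 0) h.tendsto h.nuisBlock_isBigO
    fun _ => isBigO_zero _ l).1
  filter_upwards [hunit, h.pseudo] with x h1 h2
  have hsum : ∀ k, ∑ m, gram 0 (N x) (θ x) k m * amp (θ x) m = 0 := fun k => by
    have h3 := congrArg conj (resid_zero_eq_zero h2 k)
    have h4 : resid S 0 (N x) (θ x) k = ∑ m, (amp (θ x) m : ℂ) * gram 0 (N x) (θ x) m k := by
      simp only [resid, gram, waveDiff, h0, sub_zero, harmWave_eq, map_sum, Finset.mul_sum,
        Finset.sum_mul]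
      rw [Finset.sum_comm]
      refine Finset.sum_congr rfl fun m _ => Finset.sum_congr rfl fun t _ => ?_
      rw [map_mul, Complex.conj_ofReal]
      ring
    rw [h4, map_sum, map_zero] at h3
    rw [← h3]
    refine Finset.sum_congr rfl fun m _ => ?_
    rw [map_mul, Complex.conj_ofReal, gram_conj, mul_comm]
  have hker : nuisBlock (N x) (θ x) *ᵥ (Sum.elim (fun _ => 0) fun m => amp (θ x) m) = 0 := by
    ext i
    rcases i with k | k
    · have h3 := congrArg Complex.im (hsum k)
      simpa [nuisBlock, Matrix.mulVec, dotProduct] using h3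
    · have h3 := congrArg Complex.re (hsum k)
      simpa [nuisBlock, Matrix.mulVec, dotProduct] using h3
  have h5 := Matrix.eq_zero_of_mulVec_eq_zero (isUnit_iff_ne_zero.1 h1) hker
  have h6 := congrFun h5 (Sum.inr ⟨0, hK⟩)
  exact (h2.1.2.2 ⟨0, hK⟩).ne' h6

/-- The complex amplitude of the signal at the frequency `f`. -/
def spectralCoeff (S : SignalModel K) (f : ℝ) : ℂ :=
  ∑ k with S.freq k = f, (S.amp k : ℂ) * Complex.exp ((S.phase k : ℂ) * Complex.I)

theorem wave_eq_zero_of_spectralCoeff (h : ∀ k, spectralCoeff S (S.freq k) = 0) (t : ℕ) :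
    S.wave t = 0 := by
  rw [wave_eq, ← Finset.sum_fiberwise_of_maps_to (t := Finset.univ.image S.freq)
    (fun k _ => Finset.mem_image_of_mem _ (Finset.mem_univ k))]
  refine Finset.sum_eq_zero fun f hf => ?_
  obtain ⟨k, -, rfl⟩ := Finset.mem_image.1 hf
  have h1 : ∑ m with S.freq m = S.freq k, (S.amp m : ℂ) * sigTone S m t =
      spectralCoeff S (S.freq k) * tone 0 (S.freq k) t := by
    rw [spectralCoeff, Finset.sum_mul]
    refine Finset.sum_congr rfl fun m hm => ?_
    have hm' : S.freq m = S.freq k := (Finset.mem_filter.1 hm).2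
    rw [sigTone, tone, tone, hm', mul_assoc, ← Complex.exp_add]
    congr 2
    push_cast
    ring
  rw [h1, h, zero_mul]

/-- Components at the frequency f add coherently. The others have fixed distinct frequencies, so
their correlations with the tone are bounded by constants depending on the signal. -/
theorem corr_wave_tone_sub_isBigO (f : ℝ) (hf : f ∈ Set.Ico (-Real.pi) Real.pi)
    (β : ℝ) :
    (fun x => corr (N x) S.wave (tone β f) -
      N x * (conj (spectralCoeff S f) * Complex.exp ((β : ℂ) * Complex.I))) =O[l]
      fun x => (N x : ℝ) ^ 0 := by
  have hoff : (fun x => ∑ k with S.freq k ≠ f, (S.amp k : ℂ) *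
      corr (N x) (sigTone S k) (tone β f)) =O[l] fun x => (N x : ℝ) ^ 0 := by
    refine IsBigO.fun_sum fun k hk => IsBigO.const_mul_left ?_ _
    obtain ⟨b, hb⟩ := exists_norm_corr_tone_le (S.freq_mem k) hf (Finset.mem_filter.1 hk).2
    refine IsBigO.of_bound b (Eventually.of_forall fun x => ?_)
    rw [pow_zero, norm_one, mul_one]
    exact hb (N x) (S.phase k) β
  refine hoff.congr_left fun x => ?_
  have h1 : corr (N x) S.wave (tone β f) =
      ∑ k, (S.amp k : ℂ) * corr (N x) (sigTone S k) (tone β f) := by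
    simp only [corr, wave_eq, map_sum, Finset.sum_mul, Finset.mul_sum]
    rw [Finset.sum_comm]
    refine Finset.sum_congr rfl fun k _ => Finset.sum_congr rfl fun t _ => ?_
    rw [map_mul, Complex.conj_ofReal]
    ring
  rw [h1, ← Finset.sum_filter_add_sum_filter_not Finset.univ (fun k => S.freq k = f), eq_comm,
    sub_eq_iff_eq_add, add_comm]
  congr 1
  rw [spectralCoeff, map_sum, Finset.sum_mul, Finset.mul_sum]
  refine Finset.sum_congr rfl fun k hk => ?_
  have hk' : S.freq k = f := (Finset.mem_filter.1 hk).2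
  have h2 : ∀ t, conj (sigTone S k t) * tone β f t =
      conj (Complex.exp ((S.phase k : ℂ) * Complex.I)) * Complex.exp ((β : ℂ) * Complex.I) := by
    intro t
    rw [sigTone, conj_tone_mul_tone, hk', ← Complex.exp_conj, ← Complex.exp_add, tone]
    congr 1
    simp
    ring
  simp only [corr, h2, Finset.sum_const, Finset.card_range, nsmul_eq_mul, map_mul,
    Complex.conj_ofReal]
  ring

/-- Some harmonic of the pseudo-true fundamental frequency is within `O(1/N)` of the frequency of
the corresponding component. -/
theorem exists_active (hK : 0 < K) (h : Regime c κ l N (fun _ => S) θ) :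
    ∃ M : ℝ, ∀ᶠ x in l, ∃ k, |order k * pitch (θ x) - S.freq k| ≤ M / N x := by
  by_cases hzero : ∀ k, spectralCoeff S (S.freq k) = 0
  · refine ⟨0, ?_⟩
    filter_upwards [h.eventually_false_of_wave_eq_zero hK (wave_eq_zero_of_spectralCoeff hzero)]
      with x hx using hx.elim
  push Not at hzero
  obtain ⟨k₀, hk₀⟩ := hzero
  set f := S.freq k₀ with hf_def
  set z := spectralCoeff S f with hz_def
  have hz : 0 < ‖z‖ := norm_pos_iff.2 hk₀
  have ho : order k₀ ≠ 0 := (zero_lt_one.trans_le (one_le_order k₀)).ne'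
  -- A competitor with one tone that matches the spectral line z at f. It lowers the energy of the
  -- signal by N‖z‖² up to O(1).
  let η : Param K := Sum.elim (fun _ => f / order k₀)
    (Sum.elim (fun _ => Complex.arg z) fun k => if k = k₀ then ‖z‖ else 0)
  have hη : ∀ k, 0 ≤ amp η k := fun k => by
    simp only [η, amp, Sum.elim_inr]
    split_ifs
    exacts [hz.le, le_rfl]
  have hwη : ∀ t, harmWave t η = (‖z‖ : ℂ) * tone (Complex.arg z) f t := fun t => by
    rw [harmWave_eq, Finset.sum_eq_single k₀]
    · simp [η, amp, harmTone, phase, pitch, mul_div_cancel₀ _ ho]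
    · intro m _ hm
      simp [η, amp, hm]
    · simp
  have hcorr := corr_wave_tone_sub_isBigO (l := l) (N := N) (S := S) f (S.freq_mem k₀)
    (Complex.arg z)
  have hcross : (fun x => corr (N x) S.wave (fun t => harmWave t (θ x)) -
      ∑ k, ((S.amp k : ℂ) * amp (θ x) k) * crossCorr S 0 (N x) (θ x) k k) =O[l]
      fun x => (N x : ℝ) ^ 0 := by
    have h1 : (fun x => ∑ k, ∑ m ∈ Finset.univ.erase k, ((S.amp k : ℂ) * amp (θ x) m) *
        crossCorr S 0 (N x) (θ x) k m) =O[l] fun x => (N x : ℝ) ^ 0 := by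
      refine IsBigO.fun_sum fun k _ => IsBigO.fun_sum fun m hm => ?_
      have h2 := ((ofReal_isBigO (h.sigAmp k)).mul (ofReal_isBigO (h.amp_isBigO m))).mul
        (h.crossCorr_isBigO 0 (Finset.ne_of_mem_erase hm).symm)
      simpa only [pow_zero, one_mul] using h2
    refine h1.congr_left fun x => ?_
    have h3 : corr (N x) S.wave (fun t => harmWave t (θ x)) =
        ∑ k, ∑ m, ((S.amp k : ℂ) * amp (θ x) m) * crossCorr S 0 (N x) (θ x) k m := by
      have h4 : S.wave = fun t => ∑ k, (S.amp k : ℂ) * sigTone S k t := funext fun t => wave_eq S t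
      rw [h4]
      simp only [harmWave_eq]
      rw [corr_sum_sum]
      refine Finset.sum_congr rfl fun k _ => Finset.sum_congr rfl fun m _ => ?_
      rw [← corr_sigTone_harmTone, corr, corr, Finset.mul_sum]
      refine Finset.sum_congr rfl fun t _ => ?_
      rw [map_mul, Complex.conj_ofReal]
      ring
    rw [h3, ← Finset.sum_sub_distrib]
    refine Finset.sum_congr rfl fun k _ => ?_
    rw [← Finset.add_sum_erase _ _ (Finset.mem_univ k), add_sub_cancel_left]
  have hR : (fun x => ∑ k, S.amp k * amp (θ x) k) =O[l] fun x => (N x : ℝ) ^ 0 :=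
    IsBigO.fun_sum fun k _ => (h.amp_isBigO k).const_mul_left _
  obtain ⟨b₁, hb₁⟩ := hcorr.bound
  obtain ⟨b₂, hb₂⟩ := hcross.bound
  obtain ⟨b₃, hb₃⟩ := hR.bound
  have hpi := Real.pi_pos
  refine ⟨8 * Real.pi * (|b₃| + 1) / ‖z‖ ^ 2, ?_⟩
  -- Chosen so that, if every harmonic misses its component by more than M/N, the same-order
  -- correlations total at most N‖z‖²/8. The fit then gains at most N‖z‖²/4 + O(1), less than the
  -- competitor.
  set M := 8 * Real.pi * (|b₃| + 1) / ‖z‖ ^ 2 with hM_def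
  have hM : 0 < M := by positivity
  have hlarge := (tendsto_natCast_atTop_atTop (R := ℝ).comp h.tendsto).eventually_ge_atTop
    ((8 * (‖z‖ * b₁ + b₂) + 1) / ‖z‖ ^ 2)
  filter_upwards [hb₁, hb₂, hb₃, hlarge, h.pseudo, h.almost, h.tendsto.eventually_ge_atTop 1]
    with x h1 h2 h3 h4 h5 h6 h7
  by_contra! hcon
  have hN0 : (0 : ℝ) < N x := by exact_mod_cast h7
  replace h4 : (8 * (‖z‖ * b₁ + b₂) + 1) / ‖z‖ ^ 2 ≤ (N x : ℝ) := h4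
  rw [div_le_iff₀ (by positivity)] at h4
  simp only [pow_zero, norm_one, mul_one] at h1 h2 h3
  have hc1 := sum_norm_sq_le_of_nonneg h5 hη
  have e1 := sum_norm_add_sq (N x) S.wave (fun t => -harmWave t (θ x))
  have e2 := sum_norm_add_sq (N x) S.wave (fun t => -harmWave t η)
  have hneg : ∀ g : ℕ → ℂ, (corr (N x) S.wave fun t => -g t) = -corr (N x) S.wave g := fun g => by
    simp [corr]
  simp only [← sub_eq_add_neg, norm_neg, hneg, Complex.neg_re] at e1 e2
  have e3 : ∑ t ∈ Finset.range (N x), ‖harmWave t η‖ ^ 2 = N x * ‖z‖ ^ 2 := by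
    simp [hwη, norm_tone]
  have e4 : (corr (N x) S.wave fun t => harmWave t η) =
      (‖z‖ : ℂ) * corr (N x) S.wave (tone (Complex.arg z) f) := by
    simp only [corr, hwη, Finset.mul_sum]
    exact Finset.sum_congr rfl fun t _ => by ring
  have e5 : ‖(corr (N x) S.wave fun t => harmWave t η) - ((N x * ‖z‖ ^ 2 : ℝ) : ℂ)‖ ≤
      ‖z‖ * b₁ := by
    have e6 : (corr (N x) S.wave fun t => harmWave t η) - ((N x * ‖z‖ ^ 2 : ℝ) : ℂ) =
        (‖z‖ : ℂ) * (corr (N x) S.wave (tone (Complex.arg z) f) -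
          N x * (conj z * Complex.exp ((Complex.arg z : ℂ) * Complex.I))) := by
      rw [e4]
      have e7 : (‖z‖ : ℂ) * (conj z * Complex.exp ((Complex.arg z : ℂ) * Complex.I)) =
          (‖z‖ : ℂ) ^ 2 := by
        rw [← Complex.conj_mul', mul_left_comm, Complex.norm_mul_exp_arg_mul_I]
      push_cast
      linear_combination (N x : ℂ) * e7
    rw [e6, norm_mul, Complex.norm_real, norm_norm]
    exact mul_le_mul_of_nonneg_left h1 hz.le
  have e8 := (abs_le.1 ((Complex.abs_re_le_norm _).trans e5)).1
  rw [Complex.sub_re, Complex.ofReal_re] at e8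
  have e9 : ‖∑ k, ((S.amp k : ℂ) * amp (θ x) k) * crossCorr S 0 (N x) (θ x) k k‖ ≤
      Real.pi / (M / N x) * |b₃| := by
    refine (norm_sum_le _ _).trans ?_
    have hk : ∀ k ∈ Finset.univ, ‖((S.amp k : ℂ) * amp (θ x) k) *
        crossCorr S 0 (N x) (θ x) k k‖ ≤ Real.pi / (M / N x) * (S.amp k * amp (θ x) k) := by
      intro k _
      have hp : 0 ≤ S.amp k * amp (θ x) k := mul_nonneg (S.amp_pos k).le (h5.1.2.2 k).le
      rw [← Complex.ofReal_mul, norm_mul, Complex.norm_real, Real.norm_of_nonneg hp, mul_comm]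
      refine mul_le_mul_of_nonneg_right ?_ hp
      have hlow := hcon k
      have hup : |order k * pitch (θ x) - S.freq k| ≤ Real.pi :=
        (h6.abs_pitch_le h.kappa_lt k).trans (abs_le.2 ⟨h5.1.1.1, h5.1.1.2.le⟩)
      rw [crossCorr_eq_oscSum]
      have := norm_oscSum_le (by positivity : 0 < M / N x) hlow.le
        (by linarith) 0 (N x) (phase (θ x) k - S.phase k)
      simpa using this
    refine (Finset.sum_le_sum hk).trans ?_
    rw [← Finset.mul_sum]
    refine mul_le_mul_of_nonneg_left ?_ (by positivity)
    exact (le_abs_self _).trans (h3.trans (le_abs_self _))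
  have e10 : Real.pi / (M / N x) * |b₃| ≤ N x * ‖z‖ ^ 2 / 8 := by
    rw [hM_def]
    have : Real.pi / (8 * Real.pi * (|b₃| + 1) / ‖z‖ ^ 2 / N x) * |b₃| =
        N x * ‖z‖ ^ 2 / 8 * (|b₃| / (|b₃| + 1)) := by
      field_simp
    rw [this]
    refine mul_le_of_le_one_right (by positivity) ?_
    rw [div_le_one (by positivity)]
    linarith
  have e11 : (corr (N x) S.wave fun t => harmWave t (θ x)).re ≤ b₂ + N x * ‖z‖ ^ 2 / 8 := by
    refine (Complex.re_le_norm _).trans ?_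
    have := norm_sub_norm_le (corr (N x) S.wave fun t => harmWave t (θ x))
      (∑ k, ((S.amp k : ℂ) * amp (θ x) k) * crossCorr S 0 (N x) (θ x) k k)
    linarith
  have e12 : 0 ≤ ∑ t ∈ Finset.range (N x), ‖harmWave t (θ x)‖ ^ 2 :=
    Finset.sum_nonneg fun t _ => by positivity
  have e13 : 0 ≤ (N x : ℝ) * ‖z‖ ^ 2 := by positivity
  linarith

end Regime

/-! ### Nondegeneracy for a fixed signal -/

section
variable {K : ℕ}

/-- The amplitudes of the components of the signal whose frequencies are exact multiples
of `f`; the other amplitudes are replaced by zero. -/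
def alignedAmp (S : SignalModel K) (f : ℝ) (k : Fin K) : ℝ :=
  open Classical in if S.freq k = order k * f then S.amp k else 0

theorem alignedAmp_of_eq {S : SignalModel K} {f : ℝ} {k : Fin K} (h : S.freq k = order k * f) :
    alignedAmp S f k = S.amp k := if_pos h

theorem alignedAmp_of_ne {S : SignalModel K} {f : ℝ} {k : Fin K} (h : S.freq k ≠ order k * f) :
    alignedAmp S f k = 0 := if_neg h

theorem alignedAmp_nonneg (S : SignalModel K) (f : ℝ) (k : Fin K) : 0 ≤ alignedAmp S f k := by
  rw [alignedAmp]
  split_ifs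
  exacts [(S.amp_pos k).le, le_rfl]

/-- The deviation of the `k`-th aligned component from the `k`-th harmonic. -/
def deviation (S : SignalModel K) (f : ℝ) (θ : Param K) (k : Fin K) (t : ℕ) : ℂ :=
  alignedAmp S f k * sigTone S k t - amp θ k * harmTone θ k t

theorem corr_deviation (S : SignalModel K) (f : ℝ) (N : ℕ) (θ : Param K) (k m : Fin K) :
    corr N (deviation S f θ k) (deviation S f θ m) =
      alignedAmp S f k * (alignedAmp S f m * corr N (sigTone S k) (sigTone S m)) -
      alignedAmp S f k * (amp θ m * crossCorr S 0 N θ k m) -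
      alignedAmp S f m * (amp θ k * conj (crossCorr S 0 N θ m k)) +
      amp θ k * (amp θ m * gram 0 N θ k m) := by
  rw [← corr_sigTone_harmTone, ← corr_sigTone_harmTone, corr_conj, ← corr_harmTone]
  simp only [corr, Finset.mul_sum]
  rw [← Finset.sum_sub_distrib, ← Finset.sum_sub_distrib, ← Finset.sum_add_distrib]
  refine Finset.sum_congr rfl fun t _ => ?_
  simp only [deviation, map_sub, map_mul, Complex.conj_ofReal]
  ring

theorem corr_sigTone_deviation (S : SignalModel K) (f : ℝ) (N : ℕ) (θ : Param K) (k m : Fin K) :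
    corr N (sigTone S k) (deviation S f θ m) =
      alignedAmp S f m * corr N (sigTone S k) (sigTone S m) - amp θ m * crossCorr S 0 N θ k m := by
  rw [← corr_sigTone_harmTone]
  simp only [corr, Finset.mul_sum]
  rw [← Finset.sum_sub_distrib]
  refine Finset.sum_congr rfl fun t _ => ?_
  simp only [deviation]
  ring

theorem norm_harmTone (θ : Param K) (k : Fin K) (t : ℕ) : ‖harmTone θ k t‖ = 1 := norm_tone _ _ _

theorem norm_sigTone (S : SignalModel K) (k : Fin K) (t : ℕ) : ‖sigTone S k t‖ = 1 :=
  norm_tone _ _ _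

/-- Multiplying the deviation by the unimodular model tone turns the left side into a sum with
weights t^j. Cauchy–Schwarz and ∑ t^{2j} ≤ N^{2j+1} finish. -/
theorem norm_sq_aligned_sub_le (S : SignalModel K) (f : ℝ) (j N : ℕ) (θ : Param K) (k : Fin K) :
    ‖(alignedAmp S f k : ℂ) * crossCorr S j N θ k k - (amp θ k * powSum j N : ℝ)‖ ^ 2 ≤
      (N : ℝ) ^ (2 * j + 1) * ∑ t ∈ Finset.range N, ‖deviation S f θ k t‖ ^ 2 := by
  have h1 : (alignedAmp S f k : ℂ) * crossCorr S j N θ k k - (amp θ k * powSum j N : ℝ) =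
      ∑ t ∈ Finset.range N, (t : ℂ) ^ j * (conj (deviation S f θ k t) * harmTone θ k t) := by
    have h2 : ∀ t : ℕ, (t : ℂ) ^ j * (conj (deviation S f θ k t) * harmTone θ k t) =
        (alignedAmp S f k : ℂ) * ((t : ℂ) ^ j * (conj (sigTone S k t) * harmTone θ k t)) -
          (amp θ k : ℂ) * (t : ℂ) ^ j := fun t => by
      have h3 : conj (harmTone θ k t) * harmTone θ k t = 1 := conj_tone_mul_self _ _ _
      simp only [deviation, map_sub, map_mul, Complex.conj_ofReal]
      linear_combination (-(amp θ k * (t : ℂ) ^ j)) * h3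
    simp only [h2]
    rw [Finset.sum_sub_distrib, ← Finset.mul_sum, ← Finset.mul_sum, ← crossCorr, powSum]
    push_cast
    rfl
  have h4 : ‖∑ t ∈ Finset.range N, (t : ℂ) ^ j *
      (conj (deviation S f θ k t) * harmTone θ k t)‖ ≤
      ∑ t ∈ Finset.range N, (t : ℝ) ^ j * ‖deviation S f θ k t‖ := by
    refine (norm_sum_le _ _).trans_eq (Finset.sum_congr rfl fun t _ => ?_)
    rw [norm_mul, norm_mul, norm_harmTone, mul_one, RCLike.norm_conj, norm_pow,
      Complex.norm_natCast]
  rw [h1]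
  refine (pow_le_pow_left₀ (norm_nonneg _) h4 2).trans ?_
  refine (Finset.sum_mul_sq_le_sq_mul_sq _ _ _).trans ?_
  refine mul_le_mul_of_nonneg_right ?_ (Finset.sum_nonneg fun t _ => by positivity)
  have h5 := powSum_le (2 * j) N
  rw [powSum] at h5
  refine le_trans (le_of_eq (Finset.sum_congr rfl fun t _ => ?_)) h5
  rw [← pow_mul, mul_comm]

theorem mul_sq_sub_le (S : SignalModel K) (f : ℝ) (N : ℕ) {θ : Param K} {k : Fin K}
    (hr : 0 ≤ amp θ k) :
    (N : ℝ) * (alignedAmp S f k - amp θ k) ^ 2 ≤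
      ∑ t ∈ Finset.range N, ‖deviation S f θ k t‖ ^ 2 := by
  have h1 : ∀ t ∈ Finset.range N, (alignedAmp S f k - amp θ k) ^ 2 ≤ ‖deviation S f θ k t‖ ^ 2 := by
    intro t _
    have h2 := abs_norm_sub_norm_le ((alignedAmp S f k : ℂ) * sigTone S k t)
      ((amp θ k : ℂ) * harmTone θ k t)
    rw [norm_mul, norm_mul, norm_sigTone, norm_harmTone, mul_one, mul_one, Complex.norm_real,
      Complex.norm_real, Real.norm_of_nonneg (alignedAmp_nonneg S f k),
      Real.norm_of_nonneg hr] at h2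
    rw [← sq_abs]
    exact pow_le_pow_left₀ (abs_nonneg _) h2 2
  simpa using Finset.sum_le_sum h1

end

/-! ### Cubic lower bound for the denominator -/

namespace Regime
open Matrix
variable {K : ℕ} {X : Type*} {c κ : ℝ} {l : Filter X} {N : X → ℕ}
variable {S : SignalModel K} {θ : X → Param K}

/-- The pitch is within O(1/N) of f, so a component off the grid of f stays at least half its fixed
distance γ away from its harmonic. -/
theorem crossCorr_self_isBigO (h : Regime c κ l N (fun _ => S) θ) {M f : ℝ}
    (hf : ∀ᶠ x in l, |pitch (θ x) - f| ≤ M / N x) {k : Fin K} (hk : S.freq k ≠ order k * f)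
    (j : ℕ) :
    (fun x => crossCorr S j (N x) (θ x) k k) =O[l] fun x => (N x : ℝ) ^ j := by
  set γ := |order k * f - S.freq k| with hγ
  have hγ0 : 0 < γ := abs_pos.2 (sub_ne_zero.2 hk.symm)
  have hok : 0 < order k := zero_lt_one.trans_le (one_le_order k)
  refine IsBigO.of_bound (Real.pi / (γ / 2)) ?_
  have hlarge := (tendsto_natCast_atTop_atTop (R := ℝ).comp h.tendsto).eventually_ge_atTop
    (2 * order k * M / γ)
  filter_upwards [hf, h.pseudo, h.almost, hlarge, h.tendsto.eventually_ge_atTop 1]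
    with x h1 h2 h3 h4 h5
  replace h4 : 2 * order k * M / γ ≤ (N x : ℝ) := h4
  have hN0 : (0 : ℝ) < N x := by exact_mod_cast h5
  have hup : |order k * pitch (θ x) - S.freq k| ≤ Real.pi :=
    (h3.abs_pitch_le h.kappa_lt k).trans (abs_le.2 ⟨h2.1.1.1, h2.1.1.2.le⟩)
  have hlow : γ / 2 ≤ |order k * pitch (θ x) - S.freq k| := by
    have e1 : γ ≤ |order k * pitch (θ x) - S.freq k| + |order k * (pitch (θ x) - f)| := by
      rw [hγ, show order k * f - S.freq k =
        (order k * pitch (θ x) - S.freq k) - order k * (pitch (θ x) - f) by ring]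
      exact abs_sub _ _
    have e2 : |order k * (pitch (θ x) - f)| ≤ order k * (M / N x) := by
      rw [abs_mul, abs_of_pos hok]
      exact mul_le_mul_of_nonneg_left h1 hok.le
    have e3 : order k * (M / N x) ≤ γ / 2 := by
      rw [← mul_div_assoc, div_le_iff₀ hN0]
      rw [div_le_iff₀ hγ0] at h4
      linarith
    linarith
  rw [crossCorr_eq_oscSum, Real.norm_of_nonneg (by positivity)]
  exact norm_oscSum_le (half_pos hγ0) hlow (by linarith) _ _ _

/-- If the frequencies agreed, the k-th harmonic would lie within O(1/N) of the m-th component,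
against the cross separation. The conclusion does not involve the index x, so one large sample
suffices; this is where the filter must be nontrivial. -/
theorem freq_ne_of_aligned [l.NeBot] (h : Regime c κ l N (fun _ => S) θ) {M f : ℝ}
    (hf : ∀ᶠ x in l, |pitch (θ x) - f| ≤ M / N x) {k m : Fin K} (hkm : k ≠ m)
    (hk : S.freq k = order k * f) : S.freq k ≠ S.freq m := by
  intro heq
  have hok : 0 < order k := zero_lt_one.trans_le (one_le_order k)
  have hε : 0 < (1 - κ) * c := mul_pos (sub_pos.2 h.kappa_lt) h.c_pos
  have hlarge := (tendsto_natCast_atTop_atTop (R := ℝ).comp h.tendsto).eventually_ge_atTop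
    ((order k * M + 1) / ((1 - κ) * c))
  obtain ⟨x, h1, h2, h3, h4⟩ :=
    (hf.and (h.almost.and (hlarge.and (h.tendsto.eventually_ge_atTop 1)))).exists
  replace h3 : (order k * M + 1) / ((1 - κ) * c) ≤ (N x : ℝ) := h3
  have hN0 : (0 : ℝ) < N x := by exact_mod_cast h4
  have e1 := (h2.cross_separated h.c_pos h.kappa_lt hkm).1
  rw [← heq, hk, ← mul_sub, abs_mul, abs_of_pos hok] at e1
  have e2 := e1.trans (mul_le_mul_of_nonneg_left h1 hok.le)
  rw [← mul_div_assoc, le_div_iff₀ hN0] at e2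
  rw [div_le_iff₀ hε] at h3
  linarith

theorem conj_isBigO {f : X → ℂ} {g : X → ℝ} (hf : f =O[l] g) : (fun x => conj (f x)) =O[l] g :=
  (IsBigO.of_norm_le fun x => (RCLike.norm_conj (f x)).le).trans hf.norm_left

/-- The total energy of the deviations of the harmonics from the aligned components is bounded. -/
theorem deviation_isBigO [l.NeBot] (h : Regime c κ l N (fun _ => S) θ) {M f : ℝ}
    (hf : ∀ᶠ x in l, |pitch (θ x) - f| ≤ M / N x) (k : Fin K) :
    (fun x => ∑ t ∈ Finset.range (N x), ‖deviation S f (θ x) k t‖ ^ 2) =O[l]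
      fun x => (N x : ℝ) ^ 0 := by
  have hsig : ∀ {i m : Fin K}, i ≠ m → (S.freq i = order i * f ∨ S.freq m = order m * f) →
      (fun x => corr (N x) (sigTone S i) (sigTone S m)) =O[l] fun x => (N x : ℝ) ^ 0 := by
    intro i m him hor
    have hne : S.freq i ≠ S.freq m := by
      rcases hor with hi | hm
      · exact h.freq_ne_of_aligned hf him hi
      · exact (h.freq_ne_of_aligned hf him.symm hm).symm
    obtain ⟨b, hb⟩ := exists_norm_corr_tone_le (S.freq_mem i) (S.freq_mem m) hne
    refine IsBigO.of_bound b (Eventually.of_forall fun x => ?_)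
    rw [pow_zero, norm_one, mul_one]
    exact hb (N x) (S.phase i) (S.phase m)
  have hbsig : ∀ {i m : Fin K}, i ≠ m → (fun x => (alignedAmp S f m : ℂ) *
      corr (N x) (sigTone S i) (sigTone S m)) =O[l] fun x => (N x : ℝ) ^ 0 := by
    intro i m him
    by_cases hm : S.freq m = order m * f
    · exact (hsig him (Or.inr hm)).const_mul_left _
    · simpa [alignedAmp_of_ne hm] using isBigO_zero (E' := ℂ) (fun _ : X => (1 : ℝ)) l
  have hamp : ∀ (m : Fin K) {g : X → ℂ}, g =O[l] (fun x => (N x : ℝ) ^ 0) →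
      (fun x => (amp (θ x) m : ℂ) * g x) =O[l] fun x => (N x : ℝ) ^ 0 := fun m g hg => by
    simpa only [pow_zero, one_mul] using (ofReal_isBigO (h.amp_isBigO m)).mul hg
  have hdev : ∀ {i m : Fin K}, i ≠ m → (fun x => corr (N x) (deviation S f (θ x) i)
      (deviation S f (θ x) m)) =O[l] fun x => (N x : ℝ) ^ 0 := by
    intro i m him
    simp only [corr_deviation]
    refine ((((hbsig him).const_mul_left _).sub
      ((hamp m (h.crossCorr_isBigO 0 him)).const_mul_left _)).sub
      ((hamp i (conj_isBigO (h.crossCorr_isBigO 0 him.symm))).const_mul_left _)).add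
      (hamp i (hamp m (h.gram_isBigO 0 him)))
  have hrest : ∀ i m : Fin K, (fun x => ((S.amp i - alignedAmp S f i : ℝ) : ℂ) *
      corr (N x) (sigTone S i) (deviation S f (θ x) m)) =O[l] fun x => (N x : ℝ) ^ 0 := by
    intro i m
    by_cases hi : S.freq i = order i * f
    · simpa [alignedAmp_of_eq hi] using isBigO_zero (E' := ℂ) (fun _ : X => (1 : ℝ)) l
    · refine IsBigO.const_mul_left ?_ _
      simp only [corr_sigTone_deviation]
      by_cases him : i = m
      · subst him
        refine IsBigO.sub ?_ (hamp i (h.crossCorr_self_isBigO hf hi 0))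
        simpa [alignedAmp_of_ne hi] using isBigO_zero (E' := ℂ) (fun _ : X => (1 : ℝ)) l
      · exact (hbsig him).sub (hamp m (h.crossCorr_isBigO 0 him))
  have hA : (fun x => ∑ i, ∑ m, ((S.amp i - alignedAmp S f i : ℝ) : ℂ) *
      corr (N x) (sigTone S i) (deviation S f (θ x) m)) =O[l] fun x => (N x : ℝ) ^ 0 :=
    IsBigO.fun_sum fun i _ => IsBigO.fun_sum fun m _ => hrest i m
  have hB : (fun x => ∑ i, ∑ m ∈ Finset.univ.erase i, corr (N x) (deviation S f (θ x) i)
      (deviation S f (θ x) m)) =O[l] fun x => (N x : ℝ) ^ 0 :=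
    IsBigO.fun_sum fun i _ => IsBigO.fun_sum fun m hm => hdev (Finset.ne_of_mem_erase hm).symm
  -- With J the non-aligned part of the signal and y the sum of the deviations, minimality reads ‖J
  -- + y‖² ≤ ‖J‖², so ‖y‖² ≤ -2 Re⟨J, y⟩. Expanding ‖y‖² leaves the separate energies bounded by
  -- cross correlations, all O(1).
  refine IsBigO.trans (IsBigO.of_bound 1 ?_)
    (((isBigO_re hA).const_mul_left (-2)).sub (isBigO_re hB))
  filter_upwards [h.pseudo] with x hx
  let η : Param K := Sum.elim (fun _ => f) (Sum.elim S.phase (alignedAmp S f))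
  have hη : ∀ i, 0 ≤ amp η i := alignedAmp_nonneg S f
  have hle := sum_norm_sq_le_of_nonneg hx hη
  let J : ℕ → ℂ := fun t => ∑ i, ((S.amp i - alignedAmp S f i : ℝ) : ℂ) * sigTone S i t
  let y : ℕ → ℂ := fun t => ∑ i, deviation S f (θ x) i t
  have hJ : ∀ t, S.wave t - harmWave t η = J t := fun t => by
    rw [wave_eq, harmWave_eq, ← Finset.sum_sub_distrib]
    refine Finset.sum_congr rfl fun i _ => ?_
    by_cases hi : S.freq i = order i * f
    · have : harmTone η i t = sigTone S i t := by
        rw [sigTone, hi]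
        rfl
      rw [this, show amp η i = alignedAmp S f i from rfl]
      push_cast
      ring
    · rw [show amp η i = alignedAmp S f i from rfl, alignedAmp_of_ne hi]
      push_cast
      ring
  have hy : ∀ t, S.wave t - harmWave t (θ x) = J t + y t := fun t => by
    rw [wave_eq, harmWave_eq, ← Finset.sum_sub_distrib, ← Finset.sum_add_distrib]
    refine Finset.sum_congr rfl fun i _ => ?_
    rw [deviation]
    push_cast
    ring
  simp only [hJ, hy] at hle
  rw [sum_norm_add_sq] at hle
  have hcorrJ : corr (N x) J y = ∑ i, ∑ m, ((S.amp i - alignedAmp S f i : ℝ) : ℂ) *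
      corr (N x) (sigTone S i) (deviation S f (θ x) m) := by
    rw [corr_sum_sum]
    refine Finset.sum_congr rfl fun i _ => Finset.sum_congr rfl fun m _ => ?_
    rw [corr, corr, Finset.mul_sum]
    refine Finset.sum_congr rfl fun t _ => ?_
    rw [map_mul, Complex.conj_ofReal, mul_assoc]
  have hyy : ((∑ t ∈ Finset.range (N x), ‖y t‖ ^ 2 : ℝ) : ℂ) =
      ∑ i, (((∑ t ∈ Finset.range (N x), ‖deviation S f (θ x) i t‖ ^ 2 : ℝ) : ℂ) +
        ∑ m ∈ Finset.univ.erase i,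
          corr (N x) (deviation S f (θ x) i) (deviation S f (θ x) m)) := by
    rw [← corr_self, corr_sum_sum]
    refine Finset.sum_congr rfl fun i _ => ?_
    rw [← Finset.add_sum_erase _ _ (Finset.mem_univ i), corr_self]
  rw [Finset.sum_add_distrib] at hyy
  have hyr := congrArg Complex.re hyy
  rw [Complex.ofReal_re, Complex.add_re, ← Complex.ofReal_sum, Complex.ofReal_re] at hyr
  rw [← hcorrJ, one_mul, Real.norm_of_nonneg (Finset.sum_nonneg fun t _ => by positivity)]
  refine le_trans ?_ (le_abs_self _)
  have hsingle : ∑ t ∈ Finset.range (N x), ‖deviation S f (θ x) k t‖ ^ 2 ≤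
      ∑ i, ∑ t ∈ Finset.range (N x), ‖deviation S f (θ x) i t‖ ^ 2 :=
    Finset.single_le_sum (f := fun i => ∑ t ∈ Finset.range (N x), ‖deviation S f (θ x) i t‖ ^ 2)
      (fun i _ => Finset.sum_nonneg fun t _ => by positivity) (Finset.mem_univ k)
  linarith

theorem pow_isLittleO (hN : Tendsto N l atTop) {a b : ℕ} (hab : a < b) :
    (fun x => (N x : ℝ) ^ a) =o[l] fun x => (N x : ℝ) ^ b :=
  (isLittleO_pow_pow_atTop_of_lt hab).comp_tendsto
    (tendsto_natCast_atTop_atTop (R := ℝ).comp hN)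

/-- Bounded deviation energy gives O(N^{j+1/2}) by Cauchy–Schwarz. For a component off the grid, the
signal correlation itself is O(N^j). -/
theorem corrGap_isLittleO [l.NeBot] (h : Regime c κ l N (fun _ => S) θ) {M f : ℝ}
    (hf : ∀ᶠ x in l, |pitch (θ x) - f| ≤ M / N x) (j : ℕ) (k : Fin K) :
    (fun x => (S.amp k : ℂ) * crossCorr S j (N x) (θ x) k k -
      (amp (θ x) k * powSum j (N x) : ℝ)) =o[l] fun x => (N x : ℝ) ^ (j + 1) := by
  have h1 : (fun x => (alignedAmp S f k : ℂ) * crossCorr S j (N x) (θ x) k k -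
      (amp (θ x) k * powSum j (N x) : ℝ)) =o[l] fun x => (N x : ℝ) ^ (j + 1) := by
    have h2 := (isBigO_refl (fun x => (N x : ℝ) ^ (2 * j + 1)) l).mul (h.deviation_isBigO hf k)
    have h3 : (fun x => ‖(alignedAmp S f k : ℂ) * crossCorr S j (N x) (θ x) k k -
        (amp (θ x) k * powSum j (N x) : ℝ)‖ ^ 2) =O[l]
        fun x => (N x : ℝ) ^ (2 * j + 1) * (N x : ℝ) ^ 0 := by
      refine IsBigO.trans (IsBigO.of_bound 1 (Eventually.of_forall fun x => ?_)) h2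
      have h4 := norm_sq_aligned_sub_le S f j (N x) (θ x) k
      rw [one_mul, Real.norm_of_nonneg (by positivity)]
      exact h4.trans (le_abs_self _)
    simp only [pow_zero, mul_one] at h3
    have h5 := h3.trans_isLittleO (pow_isLittleO h.tendsto (show 2 * j + 1 < (j + 1) * 2 by omega))
    simp only [pow_mul _ (j + 1) 2] at h5
    exact (IsLittleO.of_pow h5 two_ne_zero).of_norm_left
  by_cases hk : S.freq k = order k * f
  · rwa [alignedAmp_of_eq hk] at h1
  · have h6 := ((h.crossCorr_self_isBigO hf hk j).const_mul_left (S.amp k : ℂ)).trans_isLittleO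
      (pow_isLittleO h.tendsto (Nat.lt_succ_self j))
    refine (h1.add h6).congr_left fun x => ?_
    rw [alignedAmp_of_ne hk]
    push_cast
    ring

/-- Every summand of Z and D contains a gap between the signal correlation and its model value, and
E consists of squares of such gaps divided by N. -/
theorem denom_sub_termC_isLittleO [l.NeBot] (h : Regime c κ l N (fun _ => S) θ) {M f : ℝ}
    (hf : ∀ᶠ x in l, |pitch (θ x) - f| ≤ M / N x) :
    (fun x => denom S (N x) (θ x) - termC (N x) (θ x)) =o[l] fun x => (N x : ℝ) ^ 3 := by
  have hre : ∀ j k, (fun x => S.amp k * (crossCorr S j (N x) (θ x) k k).re -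
      amp (θ x) k * powSum j (N x)) =o[l] fun x => (N x : ℝ) ^ (j + 1) := fun j k => by
    refine IsBigO.trans_isLittleO (IsBigO.of_norm_le fun x => ?_)
      (h.corrGap_isLittleO hf j k).norm_left
    refine le_trans (le_of_eq ?_) (Complex.abs_re_le_norm _)
    simp
  have him : ∀ k, (fun x => S.amp k * (crossCorr S 1 (N x) (θ x) k k).im) =o[l]
      fun x => (N x : ℝ) ^ 2 := fun k => by
    refine IsBigO.trans_isLittleO (IsBigO.of_norm_le fun x => ?_)
      (h.corrGap_isLittleO hf 1 k).norm_left
    refine le_trans (le_of_eq ?_) (Complex.abs_im_le_norm _)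
    simp
  have hZ : ∀ k, (fun x => amp (θ x) k * (S.amp k * (crossCorr S 2 (N x) (θ x) k k).re -
      amp (θ x) k * powSum 2 (N x))) =o[l] fun x => (N x : ℝ) ^ 3 := fun k => by
    simpa only [pow_zero, one_mul] using (h.amp_isBigO k).mul_isLittleO (hre 2 k)
  have hNsub : (fun x => (N x : ℝ) - 1) =O[l] fun x => (N x : ℝ) ^ 1 := by
    have h1 := isBigO_pow_mono h.tendsto zero_le_one (isBigO_pow_zero_const (l := l) (N := N) 1)
    refine IsBigO.sub ?_ h1
    simpa using isBigO_refl (fun x => (N x : ℝ)) l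
  have hD : ∀ k, (fun x => ((N x : ℝ) - 1) * (amp (θ x) k *
      (S.amp k * (crossCorr S 1 (N x) (θ x) k k).re - amp (θ x) k * powSum 1 (N x)))) =o[l]
      fun x => (N x : ℝ) ^ 3 := fun k => by
    have h1 := hNsub.mul_isLittleO ((h.amp_isBigO k).mul_isLittleO (hre 1 k))
    refine h1.congr_right fun x => ?_
    ring
  have hsq : ∀ {g : X → ℝ}, g =o[l] (fun x => (N x : ℝ) ^ 2) →
      (fun x => (N x : ℝ)⁻¹ * g x ^ 2) =o[l] fun x => (N x : ℝ) ^ 3 := fun {g} hg => by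
    have h1 := (isBigO_refl (fun x => (N x : ℝ)⁻¹) l).mul_isLittleO (hg.mul hg)
    refine h1.congr' (Eventually.of_forall fun x => by ring) ?_
    filter_upwards [h.tendsto.eventually_ge_atTop 1] with x hx
    have : (N x : ℝ) ≠ 0 := by
      have : 0 < N x := hx
      positivity
    field_simp
  have htot := IsLittleO.fun_sum (s := Finset.univ) fun k _ =>
    ((((hZ k).const_mul_left (2 * order k ^ 2)).sub ((hD k).const_mul_left (2 * order k ^ 2))).sub
      ((hsq (him k)).const_mul_left (2 * order k ^ 2))).sub
      ((hsq (hre 1 k)).const_mul_left (2 * order k ^ 2))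
  refine htot.congr_left fun x => ?_
  rw [denom, termE_eq, termZ_eq, termD_eq, show ∀ a b c d : ℝ, a - b + c + d - a = c + d - b by
    intros; ring, ← Finset.sum_add_distrib, ← Finset.sum_sub_distrib]
  exact Finset.sum_congr rfl fun k _ => by ring

theorem eventually_denom_ge_of_active (h : Regime c κ l N (fun _ => S) θ) {M : ℝ} {k : Fin K}
    (hk : ∀ᶠ x in l, |order k * pitch (θ x) - S.freq k| ≤ M / N x) :
    ∀ᶠ x in l, S.amp k ^ 2 / 96 * (N x : ℝ) ^ 3 ≤ denom S (N x) (θ x) := by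
  -- The lemma is later applied to filters restricted to samples where k is active, and these may be
  -- trivial.
  rcases l.eq_or_neBot with rfl | hne
  · exact eventually_bot
  have hok := one_le_order k
  have hok0 : order k ≠ 0 := by positivity
  set f := S.freq k / order k with hf_def
  have hfk : S.freq k = order k * f := (mul_div_cancel₀ _ hok0).symm
  have hf : ∀ᶠ x in l, |pitch (θ x) - f| ≤ M / N x := by
    filter_upwards [hk] with x hx
    rw [hfk, ← mul_sub, abs_mul, abs_of_pos (by positivity)] at hx
    nlinarith [abs_nonneg (pitch (θ x) - f)]
  have ha := S.amp_pos k
  obtain ⟨b, hb⟩ := (h.deviation_isBigO hf k).bound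
  have hsmall := (h.denom_sub_termC_isLittleO hf).bound (show 0 < S.amp k ^ 2 / 96 by positivity)
  have hlarge := (tendsto_natCast_atTop_atTop (R := ℝ).comp h.tendsto).eventually_ge_atTop
    (4 * b / S.amp k ^ 2)
  filter_upwards [hb, hsmall, hlarge, h.pseudo, h.tendsto.eventually_ge_atTop 2]
    with x h1 h2 h3 h4 h5
  replace h3 : 4 * b / S.amp k ^ 2 ≤ (N x : ℝ) := h3
  rw [div_le_iff₀ (by positivity)] at h3
  have hN2 : (2 : ℝ) ≤ N x := by exact_mod_cast h5
  rw [pow_zero, norm_one, mul_one] at h1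
  rw [Real.norm_of_nonneg (by positivity : (0 : ℝ) ≤ (N x : ℝ) ^ 3), Real.norm_eq_abs] at h2
  have hr0 : 0 < amp (θ x) k := h4.1.2.2 k
  -- A smaller amplitude would leave a deviation energy of more than N(a_k/2)², which is unbounded.
  have hr : S.amp k / 2 ≤ amp (θ x) k := by
    have e1 := mul_sq_sub_le S f (N x) hr0.le
    rw [alignedAmp_of_eq hfk] at e1
    have e2 := (e1.trans (le_abs_self _)).trans h1
    by_contra! hcon
    have e3 : (S.amp k / 2) ^ 2 < (S.amp k - amp (θ x) k) ^ 2 := by nlinarith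
    have e4 : (N x : ℝ) * (S.amp k / 2) ^ 2 < N x * (S.amp k - amp (θ x) k) ^ 2 :=
      mul_lt_mul_of_pos_left e3 (by linarith)
    linarith
  -- The factors are N³/12 ≤ N(N²-1)/6, valid for N ≥ 2, and r_k² ≥ a_k²/4. Half of this bound is
  -- given up to the o(N³) remainder, which yields 96.
  have hC : S.amp k ^ 2 / 48 * (N x : ℝ) ^ 3 ≤ termC (N x) (θ x) := by
    rw [termC_eq]
    have hcoef : (N x : ℝ) ^ 3 / 12 ≤ (N x : ℝ) * ((N x : ℝ) ^ 2 - 1) / 6 := by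
      nlinarith [mul_nonneg (by linarith : (0 : ℝ) ≤ N x)
        (by nlinarith : (0 : ℝ) ≤ (N x : ℝ) ^ 2 - 2)]
    have hcoef0 : (0 : ℝ) ≤ (N x : ℝ) ^ 3 / 12 := by positivity
    have e1 : (N x : ℝ) * ((N x : ℝ) ^ 2 - 1) / 6 * (order k ^ 2 * amp (θ x) k ^ 2) ≤
        ∑ k : Fin K, (N x : ℝ) * ((N x : ℝ) ^ 2 - 1) / 6 * (order k ^ 2 * amp (θ x) k ^ 2) :=
      Finset.single_le_sum (f := fun k => (N x : ℝ) * ((N x : ℝ) ^ 2 - 1) / 6 *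
        (order k ^ 2 * amp (θ x) k ^ 2)) (fun i _ => mul_nonneg (hcoef0.trans hcoef)
          (by positivity)) (Finset.mem_univ k)
    refine le_trans ?_ e1
    have e2 : S.amp k ^ 2 / 4 ≤ order k ^ 2 * amp (θ x) k ^ 2 := by
      have e3 : (S.amp k / 2) ^ 2 ≤ amp (θ x) k ^ 2 := pow_le_pow_left₀ (by positivity) hr 2
      have e4 : 1 ≤ order k ^ 2 := one_le_pow₀ hok
      nlinarith [sq_nonneg (amp (θ x) k)]
    calc S.amp k ^ 2 / 48 * (N x : ℝ) ^ 3 = (N x : ℝ) ^ 3 / 12 * (S.amp k ^ 2 / 4) := by ring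
      _ ≤ _ := mul_le_mul hcoef e2 (by positivity) (hcoef0.trans hcoef)
  have h6 := (abs_le.1 h2).1
  linarith

theorem exists_denom_ge (hK : 0 < K) (h : Regime c κ l N (fun _ => S) θ) :
    ∃ ρ : ℝ, 0 < ρ ∧ ∀ᶠ x in l, ρ * (N x : ℝ) ^ 3 ≤ denom S (N x) (θ x) := by
  obtain ⟨M, hM⟩ := h.exists_active hK
  have : Nonempty (Fin K) := ⟨⟨0, hK⟩⟩
  obtain ⟨k₀, hk₀⟩ := Finite.exists_min S.amp
  have ha := S.amp_pos k₀
  refine ⟨S.amp k₀ ^ 2 / 96, by positivity, ?_⟩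
  -- The active order may change with x, so each order is treated on the filter restricted to the
  -- points where it is active.
  have hall : ∀ k, ∀ᶠ x in l, |order k * pitch (θ x) - S.freq k| ≤ M / N x →
      S.amp k ^ 2 / 96 * (N x : ℝ) ^ 3 ≤ denom S (N x) (θ x) := fun k => by
    have hact : ∀ᶠ x in l ⊓ 𝓟 {x | |order k * pitch (θ x) - S.freq k| ≤ M / N x},
        |order k * pitch (θ x) - S.freq k| ≤ M / N x :=
      eventually_inf_principal.2 (Eventually.of_forall fun x hx => hx)
    exact eventually_inf_principal.1 ((h.mono inf_le_left).eventually_denom_ge_of_active hact)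
  filter_upwards [hM, eventually_all.2 hall] with x ⟨k, hk⟩ hx
  refine le_trans ?_ (hx k hk)
  have := hk₀ k
  gcongr

end Regime

/-- A bound that holds eventually along a filter of the form `comap fst atTop ⊓ 𝓟 P` is uniform
over the second component. -/
theorem exists_uniform_bound {Y : Type*} {P q : ℕ × Y → Prop} {g : ℕ × Y → ℝ}
    (hq : ∀ᶠ x in comap Prod.fst atTop ⊓ 𝓟 {x | P x}, q x)
    (hg : g =O[comap Prod.fst atTop ⊓ 𝓟 {x | P x}] fun x => ((x.1 : ℝ) ^ 4)⁻¹) :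
    ∃ B : ℝ, ∃ N₀ : ℕ, ∀ N : ℕ, N₀ ≤ N → ∀ y : Y, P (N, y) →
      q (N, y) ∧ |g (N, y)| ≤ B / (N : ℝ) ^ 4 := by
  obtain ⟨B, hB⟩ := hg.bound
  have h1 := hq.and hB
  rw [eventually_inf_principal, eventually_comap] at h1
  obtain ⟨N₀, hN₀⟩ := eventually_atTop.1 h1
  refine ⟨B, N₀, fun N hN y hy => ?_⟩
  obtain ⟨h2, h3⟩ := hN₀ N hN (N, y) rfl hy
  refine ⟨h2, ?_⟩
  have h4 : (0 : ℝ) ≤ ((N : ℝ) ^ 4)⁻¹ := by positivity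
  rwa [Real.norm_of_nonneg h4, Real.norm_eq_abs, ← div_eq_mul_inv] at h3

end Inharmonic

end

theorem mainTheorem3 (K : ℕ) (hK : 0 < K) (s : ℝ) (hs : 0 < s)
    (c κ : ℝ) (hc : 0 < c) (hκ : κ < 1) :
    (∀ S : Inharmonic.SignalModel K, ∃ B : ℝ, ∃ N₀ : ℕ, ∀ N : ℕ, N₀ ≤ N →
      ∀ θ : Inharmonic.Param K, Inharmonic.IsPseudoTrue S N θ →
        Inharmonic.AlmostHarmonic S c κ θ →
          IsUnit (Inharmonic.matA S s N θ).det ∧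
          0 < Inharmonic.denom S N θ ∧
          |Inharmonic.mcrlbPitch S s N θ -
              s * ((Inharmonic.termC N θ + Inharmonic.termE S N θ) /
                Inharmonic.denom S N θ ^ 2)| ≤ B / (N : ℝ) ^ 4) ∧
    (∀ a ρ : ℝ, 0 < ρ → ∃ B : ℝ, ∃ N₀ : ℕ, ∀ N : ℕ, N₀ ≤ N →
      ∀ S : Inharmonic.SignalModel K, (∀ k, S.amp k ≤ a) →
      ∀ θ : Inharmonic.Param K, Inharmonic.IsPseudoTrue S N θ →
        Inharmonic.AlmostHarmonic S c κ θ →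
        ρ * (N : ℝ) ^ 3 ≤ Inharmonic.denom S N θ →
          IsUnit (Inharmonic.matA S s N θ).det ∧
          |Inharmonic.mcrlbPitch S s N θ -
              s * ((Inharmonic.termC N θ + Inharmonic.termE S N θ) /
                Inharmonic.denom S N θ ^ 2)| ≤ B / (N : ℝ) ^ 4) := by
  constructor
  · intro S
    -- Only N is driven to infinity by this filter; θ is arbitrary subject to the hypotheses.
    -- Eventual statements are thus uniform in θ, and below in the signal as well.
    have h : Inharmonic.Regime c κ (Filter.comap Prod.fst Filter.atTop ⊓
        Filter.principal {x : ℕ × Inharmonic.Param K |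
          Inharmonic.IsPseudoTrue S x.1 x.2 ∧ Inharmonic.AlmostHarmonic S c κ x.2})
        (fun x => x.1) (fun _ => S) (fun x => x.2) :=
      { c_pos := hc
        kappa_lt := hκ
        tendsto := Filter.tendsto_comap.mono_left inf_le_left
        pseudo := Filter.eventually_inf_principal.2 (Filter.Eventually.of_forall fun _ hx => hx.1)
        almost := Filter.eventually_inf_principal.2 (Filter.Eventually.of_forall fun _ hx => hx.2)
        sigAmp := fun _ => Inharmonic.isBigO_pow_zero_const _ }
    obtain ⟨ρ, hρ, hden⟩ := h.exists_denom_ge hK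
    obtain ⟨h1, h2⟩ := h.mcrlb_isBigO hs hρ hden
    have hpos : ∀ᶠ x : ℕ × Inharmonic.Param K in Filter.comap Prod.fst Filter.atTop ⊓
        Filter.principal {x : ℕ × Inharmonic.Param K |
          Inharmonic.IsPseudoTrue S x.1 x.2 ∧ Inharmonic.AlmostHarmonic S c κ x.2},
        0 < Inharmonic.denom S x.1 x.2 := by
      filter_upwards [hden, h.tendsto.eventually_ge_atTop 1] with x hx hx1
      have : (0 : ℝ) < x.1 := by exact_mod_cast hx1
      exact lt_of_lt_of_le (by positivity) hx
    obtain ⟨B, N₀, hB⟩ := Inharmonic.exists_uniform_bound (h1.and hpos) h2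
    refine ⟨B, N₀, fun N hN θ hp ha => ?_⟩
    obtain ⟨⟨h3, h4⟩, h5⟩ := hB N hN θ ⟨hp, ha⟩
    exact ⟨h3, h4, h5⟩
  · intro a ρ hρ
    have h : Inharmonic.Regime c κ (Filter.comap Prod.fst Filter.atTop ⊓
        Filter.principal {x : ℕ × Inharmonic.SignalModel K × Inharmonic.Param K |
          (∀ k, x.2.1.amp k ≤ a) ∧ Inharmonic.IsPseudoTrue x.2.1 x.1 x.2.2 ∧
          Inharmonic.AlmostHarmonic x.2.1 c κ x.2.2 ∧
          ρ * (x.1 : ℝ) ^ 3 ≤ Inharmonic.denom x.2.1 x.1 x.2.2})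
        (fun x => x.1) (fun x => x.2.1) (fun x => x.2.2) :=
      { c_pos := hc
        kappa_lt := hκ
        tendsto := Filter.tendsto_comap.mono_left inf_le_left
        pseudo := Filter.eventually_inf_principal.2
          (Filter.Eventually.of_forall fun _ hx => hx.2.1)
        almost := Filter.eventually_inf_principal.2
          (Filter.Eventually.of_forall fun _ hx => hx.2.2.1)
        sigAmp := fun k => Asymptotics.IsBigO.of_bound a
          (Filter.eventually_inf_principal.2 (Filter.Eventually.of_forall fun x hx => by
            rw [pow_zero, norm_one, mul_one, Real.norm_of_nonneg (x.2.1.amp_pos k).le]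
            exact hx.1 k)) }
    obtain ⟨h1, h2⟩ := h.mcrlb_isBigO hs hρ (Filter.eventually_inf_principal.2
      (Filter.Eventually.of_forall fun _ hx => hx.2.2.2))
    obtain ⟨B, N₀, hB⟩ := Inharmonic.exists_uniform_bound h1 h2
    exact ⟨B, N₀, fun N hN S ha θ hp hh hd => hB N hN (S, θ) ⟨ha, hp, hh, hd⟩⟩
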